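/- Let $G=(V,E)$ be a finite connected simple graph with edge weights $w:E\to\mathbb R_{\ge 0}$. For a graph $F$ let $comp(F)$ be its number of connected components. A set $S\subseteq E(F)$ is a $j$-way split of $F$ ($j\ge1$) if $comp(F-S)=(j-1)+comp(F)$; then $j$ is the separation degree of $S$ in $F$, and, for $j\ge 2$, the density of $S$ is $w(S)/(j-1)$, where $w(S)=\sum_{e\in S}w(e)$. For $1\le k\le |V|$, the $k$-cut problem asks for a $k$-way split of $G$ of minimum weight. Greedy algorithm. Start with $C=\emptyset$. Phase one: while the separation degree of $C$ in $G$ is at most $k-4$, choose a split $C'$ of $G-C$ that has minimum density among all splits of $G-C$ of separation degree $2$ or $3$, and replace $C$ by $C\cup C'$. Phase two: let $d$ be the separation degree of $C$ in $G$, choose a minimum-weight $(k-d+1)$-way split $C'$ of $G-C$ (for $k>4$ this is a $3$- or $4$-way split), and return $C\cup C'$. Ties are broken arbitrarily. Theorem. (1) There is a function $\varepsilon:\mathbb N\to(0,\infty)$ such that for every finite graph $H$, every finite connected graph $G=(V,E)$ that does not have $H$ as a minor, every $w:E\to\mathbb R_{\ge0}$ and every integer $1\le k\le|V|$, the greedy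 algorithm is always able to make its next choice, runs its loop fewer than $k$ times, and, however ties are broken, returns a $k$-way split of $G$ of weight at most $\left(2-\varepsilon(|V(H)|)/3\right)w(S)$ for every $k$-way split $S$ of $G$; that is, it has approximation ratio $2-\varepsilon(|V(H)|)/3$ for $k$-cut. (2) If $G$ is a finite connected planar graph, the same holds with $\varepsilon=1/105$, i.e. with ratio $2-\frac1{315}\approx 1.9968$. -/

import Mathlib

namespace KCut

/-- `H` is a minor of `G`: contracting pairwise disjoint connected branch sets of `G`, and deleting
vertices and edges, yields `H`. -/
def IsMinor {W V : Type*} (H : SimpleGraph W) (G : SimpleGraph V) : Prop :=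
  ∃ B : W → Set V,
    (∀ x, (G.induce (B x)).Connected) ∧
    (∀ x y, x ≠ y → Disjoint (B x) (B y)) ∧
    (∀ x y, H.Adj x y → ∃ a ∈ B x, ∃ b ∈ B y, G.Adj a b)

/-- `G` can be drawn in the Euclidean plane: vertices are distinct points, every edge is a simple
arc joining its two ends, and the interior of an arc meets neither a vertex nor the interior of
another arc. -/
def IsPlanar {V : Type*} (G : SimpleGraph V) : Prop :=
  ∃ (p : V → EuclideanSpace ℝ (Fin 2))
    (γ : G.edgeSet → C(unitInterval, EuclideanSpace ℝ (Fin 2))),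
    Function.Injective p ∧
    (∀ e, Function.Injective (γ e)) ∧
    (∀ e, s(γ e 0, γ e 1) = Sym2.map p (e : Sym2 V)) ∧
    (∀ e, ∀ t ∈ Set.Ioo (0 : unitInterval) 1, ∀ v, γ e t ≠ p v) ∧
    (∀ e f, e ≠ f → ∀ s ∈ Set.Ioo (0 : unitInterval) 1, ∀ t ∈ Set.Ioo (0 : unitInterval) 1,
      γ e s ≠ γ f t)

section Splits

variable {V : Type*}

/-- The number of connected components. -/
noncomputable def numComp (G : SimpleGraph V) : ℕ := Nat.card G.ConnectedComponent

/-- The total weight of a set of edges. -/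
def weight (w : Sym2 V → ℝ) (S : Finset (Sym2 V)) : ℝ := ∑ e ∈ S, w e

/-- The graph obtained by removing the edges in `S`. -/
def remove (G : SimpleGraph V) (S : Finset (Sym2 V)) : SimpleGraph V := G.deleteEdges (S : Set (Sym2 V))

/-- `S` is a `j`-way split in `G`: a set of edges whose removal increases the number of connected
components by exactly `j - 1`. -/
def IsSplit (G : SimpleGraph V) (j : ℕ) (S : Finset (Sym2 V)) : Prop :=
  (S : Set (Sym2 V)) ⊆ G.edgeSet ∧ 1 ≤ j ∧ numComp (remove G S) = (j - 1) + numComp G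

/-- The separation degree of `S` in `G`: the `j` for which `S` is a `j`-way split.  (On a finite
graph, removing edges never decreases the number of components.) -/
noncomputable def sepDegree (G : SimpleGraph V) (S : Finset (Sym2 V)) : ℕ :=
  (numComp (remove G S) - numComp G) + 1

/-- The density `w(S) / (j - 1)` of a `j`-way split `S`. -/
noncomputable def density (G : SimpleGraph V) (w : Sym2 V → ℝ) (S : Finset (Sym2 V)) : ℝ :=
  weight w S / ((sepDegree G S : ℝ) - 1)

/-- `S` is a minimum (weight) `j`-way split in `G`. -/
def IsMinSplit (G : SimpleGraph V) (w : Sym2 V → ℝ) (j : ℕ) (S : Finset (Sym2 V)) : Prop :=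
  IsSplit G j S ∧ ∀ S', IsSplit G j S' → weight w S ≤ weight w S'

/-- `S` is a split in `G` that really increases the number of components and has separation degree
at most `h`. -/
def IsSplitUpTo (G : SimpleGraph V) (h : ℕ) (S : Finset (Sym2 V)) : Prop :=
  ∃ j, 2 ≤ j ∧ j ≤ h ∧ IsSplit G j S

/-- `S` has minimum density among all splits in `G` of separation degree at most `h`. -/
def IsMinDensitySplit (G : SimpleGraph V) (w : Sym2 V → ℝ) (h : ℕ) (S : Finset (Sym2 V)) : Prop :=
  IsSplitUpTo G h S ∧ ∀ S', IsSplitUpTo G h S' → density G w S ≤ density G w S'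

variable [DecidableEq V]

/-- `PhaseOne G w k i C`: after `i` iterations of the first loop, with some choice among ties, the
set of edges collected so far can be `C`.  The loop runs while the separation degree of `C` is at
most `k - 4`. -/
inductive PhaseOne (G : SimpleGraph V) (w : Sym2 V → ℝ) (k : ℕ) : ℕ → Finset (Sym2 V) → Prop
  | start : PhaseOne G w k 0 ∅
  | step {i : ℕ} {C C' : Finset (Sym2 V)} : PhaseOne G w k i C → sepDegree G C + 4 ≤ k →
      IsMinDensitySplit (remove G C) w 3 C' → PhaseOne G w k (i + 1) (C ∪ C')

/-- `D` is a possible output of the greedy algorithm: the first loop has stopped with `C`, of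
separation degree `d`, and `D` is `C` together with a minimum `(k - d + 1)`-way split of `G - C`. -/
def IsGreedyOutput (G : SimpleGraph V) (w : Sym2 V → ℝ) (k : ℕ) (D : Finset (Sym2 V)) : Prop :=
  ∃ i C C', PhaseOne G w k i C ∧ k < sepDegree G C + 4 ∧
    IsMinSplit (remove G C) w (k - sepDegree G C + 1) C' ∧ D = C ∪ C'

/-- The greedy algorithm never gets stuck, performs fewer than `k` iterations of its loop, has an
output, and, however ties are broken, returns a `k`-way split whose weight is at most `ρ` times
the weight of every `k`-way split. -/
def GreedyApproximates (ρ : ℝ) (G : SimpleGraph V) (w : Sym2 V → ℝ) (k : ℕ) : Prop :=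
  (∀ i C, PhaseOne G w k i C → i < k ∧
    (sepDegree G C + 4 ≤ k → ∃ C', IsMinDensitySplit (remove G C) w 3 C') ∧
    (k < sepDegree G C + 4 → sepDegree G C ≤ k ∧
      ∃ C', IsMinSplit (remove G C) w (k - sepDegree G C + 1) C')) ∧
  (∃ D, IsGreedyOutput G w k D) ∧
  ∀ D, IsGreedyOutput G w k D →
    IsSplit G k D ∧ ∀ S, IsSplit G k S → weight w D ≤ ρ * weight w S

end Splits

end KCut

/-! Fix a `k`-way split `S` and contract every component of `G - S`. This gives a weighted graph `Q`
on `k` cells, a minor of `G`, whose weights over ordered pairs sum to at most `2 w(S)`. Charging the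
algorithm to the weighted degrees of the cells would give the ratio 2. To beat 2, each cell gets a
smaller price.

Call a subgraph of `Q` `τ`-stable if isolating one nonisolated cell costs at least `τ`, and
isolating both ends of an edge costs at least `2τ` whenever their component has a third cell. Unions
of stable graphs are stable (`Stable.core`), so there is a largest one, the core. The price of a
cell is the largest threshold at which it counts in the core, where the least cell of a component
with one or two cells does not count.

The prices pay for the algorithm. If every 2-way split of `F = G - C` weighs at least `τ` and every
3-way split at least `2τ`, the quotient of `F` is `τ`-stable (`stable_quot`). Hence at least `k -
comp(F)` prices are at least `τ`, and one more if some component of the quotient has three cells.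
Each step of density `τ` is charged to prices not yet used; `Affordable` is the invariant. In phase
two, `exists_affordable_split` supplies a competing split within the budget. The extra price is what
pays for a cheap 3-way split when only one component is missing.

The prices are small in total (`sum_price_le`). A price is at most the degree of its cell in the
last core containing it, and an edge is counted by both ends only if it is a level edge, which
forces equal levels. If level edges between cells of low level degree carry much weight,
`price_add_price_le` along a fractional matching of them saves a fixed fraction. If they carry
little, the degrees of the low cells sum to little more than half the weight, and by sparsity of `Q`
at least three quarters of each level class is low.

Sparsity comes from excluding a complete minor (`isMinor_top_of_le_degSum`). Planar graphs have no
five-vertex complete minor, by a parity argument on winding numbers (`not_exists_disjoint_paths`).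
-/

namespace KCut
open SimpleGraph

/-! ### Counting components under edge deletion -/

section Components

variable {V : Type*}

lemma eq_of_reachable_of_adj {α : Type*} {G : SimpleGraph V} {g : V → α}
    (hg : ∀ x y, G.Adj x y → g x = g y) {x y : V} (h : G.Reachable x y) : g x = g y := by
  obtain ⟨p⟩ := h
  induction p with
  | nil => rfl
  | cons hadj _ ih => exact (hg _ _ hadj).trans ih

lemma numComp_le_of_surjective [Finite V] {I : Type*} {F : SimpleGraph V} {X : SimpleGraph I}
    {f : V → I} (hf : Function.Surjective f)
    (h : ∀ x y, F.Adj x y → X.Reachable (f x) (f y)) : numComp X ≤ numComp F := by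
  have hr : ∀ x y, F.Reachable x y →
      X.connectedComponentMk (f x) = X.connectedComponentMk (f y) := fun x y hxy =>
    eq_of_reachable_of_adj (g := fun z => X.connectedComponentMk (f z))
      (fun a b hab => ConnectedComponent.sound (h a b hab)) hxy
  refine Nat.card_le_card_of_surjective
    (ConnectedComponent.lift (fun x => X.connectedComponentMk (f x))
      fun x y p _ => hr x y p.reachable) ?_
  intro K
  induction K using ConnectedComponent.ind with
  | h i =>
    obtain ⟨x, rfl⟩ := hf i
    exact ⟨F.connectedComponentMk x, rfl⟩

lemma numComp_mono [Finite V] {F F' : SimpleGraph V} (h : F' ≤ F) : numComp F ≤ numComp F' :=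
  ConnectedComponent.card_le_card_of_le h

lemma numComp_lt [Finite V] {F F' : SimpleGraph V} (h : F' ≤ F) {x y : V}
    (hxy : F.Reachable x y) (hn : ¬ F'.Reachable x y) : numComp F < numComp F' := by
  refine lt_of_le_of_ne (numComp_mono h) fun heq => hn ?_
  have hs := ConnectedComponent.surjective_map_ofLE h
  have hb := (Nat.bijective_iff_surjective_and_card _).2 ⟨hs, heq.symm⟩
  exact ConnectedComponent.exact (hb.1 (a₁ := F'.connectedComponentMk x)
    (a₂ := F'.connectedComponentMk y) (ConnectedComponent.sound hxy))

lemma numComp_bot [Finite V] : numComp (⊥ : SimpleGraph V) = Nat.card V := by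
  refine (Nat.card_congr (Equiv.ofBijective (⊥ : SimpleGraph V).connectedComponentMk
    ⟨fun a b hab => ?_, fun K => K.exists_rep⟩)).symm
  exact reachable_bot.1 (ConnectedComponent.exact hab)

lemma numComp_eq_one {G : SimpleGraph V} (hG : G.Connected) : numComp G = 1 := by
  obtain ⟨hp, hn⟩ := connected_iff _ |>.1 hG
  have := hp.subsingleton_connectedComponent
  exact Nat.card_of_subsingleton (G.connectedComponentMk hn.some)

lemma remove_adj {G : SimpleGraph V} {S : Finset (Sym2 V)} {x y : V} :
    (remove G S).Adj x y ↔ G.Adj x y ∧ s(x, y) ∉ S := by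
  simp [remove, deleteEdges_adj]

lemma remove_le {G : SimpleGraph V} {S : Finset (Sym2 V)} : remove G S ≤ G :=
  deleteEdges_le _

lemma remove_anti {G : SimpleGraph V} {S T : Finset (Sym2 V)} (h : S ⊆ T) :
    remove G T ≤ remove G S := by
  intro x y hxy
  rw [remove_adj] at hxy ⊢
  exact ⟨hxy.1, fun hs => hxy.2 (h hs)⟩

lemma remove_empty {G : SimpleGraph V} : remove G ∅ = G := by
  ext x y
  simp [remove_adj]

lemma remove_remove [DecidableEq V] {G : SimpleGraph V} {S T : Finset (Sym2 V)} :
    remove (remove G S) T = remove G (S ∪ T) := by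
  ext x y
  simp [remove_adj, and_assoc]

/-- Sending the new component of `y` to `none`, and every other one to the old component containing
it, is injective: two old connections can only be lost through the deleted edge, and then one side
is the component of `y`. -/
lemma numComp_remove_insert [Finite V] [DecidableEq V] (G : SimpleGraph V) (e : Sym2 V)
    (T : Finset (Sym2 V)) :
    numComp (remove G (insert e T)) ≤ numComp (remove G T) + 1 := by
  classical
  induction e with
  | h x y =>
  set F := remove G T
  set F' := remove G (insert s(x, y) T)
  have hle : F' ≤ F := remove_anti (Finset.subset_insert _ _)
  have hadj : ∀ a b, F.Adj a b → F'.Adj a b ∨ s(a, b) = s(x, y) := by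
    intro a b hab
    rw [remove_adj] at hab
    by_cases h : s(a, b) = s(x, y)
    · exact Or.inr h
    · exact Or.inl (remove_adj.2 ⟨hab.1, by simp [h, hab.2]⟩)
  have key : ∀ a b, F.Reachable a b → F'.Reachable a b ∨
      (F'.Reachable a x ∧ F'.Reachable y b) ∨ (F'.Reachable a y ∧ F'.Reachable x b) := by
    rintro a b ⟨p⟩
    induction p with
    | nil => exact Or.inl (Reachable.refl _)
    | @cons u v w h p ih =>
      rcases hadj _ _ h with h' | h'
      · have hr := h'.reachable
        rcases ih with ih | ⟨i1, i2⟩ | ⟨i1, i2⟩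
        · exact Or.inl (hr.trans ih)
        · exact Or.inr (Or.inl ⟨hr.trans i1, i2⟩)
        · exact Or.inr (Or.inr ⟨hr.trans i1, i2⟩)
      · rcases Sym2.eq_iff.1 h' with ⟨rfl, rfl⟩ | ⟨rfl, rfl⟩
        · rcases ih with ih | ⟨i1, i2⟩ | ⟨i1, i2⟩
          · exact Or.inr (Or.inl ⟨Reachable.refl _, ih⟩)
          · exact Or.inr (Or.inl ⟨Reachable.refl _, i2⟩)
          · exact Or.inl i2
        · rcases ih with ih | ⟨i1, i2⟩ | ⟨i1, i2⟩
          · exact Or.inr (Or.inr ⟨Reachable.refl _, ih⟩)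
          · exact Or.inl i2
          · exact Or.inr (Or.inr ⟨Reachable.refl _, i2⟩)
  let g : F'.ConnectedComponent → Option F.ConnectedComponent := fun K =>
    if K = F'.connectedComponentMk y then none else some (K.map (Hom.ofLE hle))
  have hg : Function.Injective g := by
    intro K₁ K₂
    induction K₁ using ConnectedComponent.ind with
    | h a =>
    induction K₂ using ConnectedComponent.ind with
    | h b =>
    intro h
    by_cases ha : F'.connectedComponentMk a = F'.connectedComponentMk y <;>
      by_cases hb : F'.connectedComponentMk b = F'.connectedComponentMk y
    · exact ha.trans hb.symm
    · simp [g, ha, hb] at h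
    · simp [g, ha, hb] at h
    · simp only [g, ha, hb, if_false, Option.some.injEq] at h
      rcases key a b (ConnectedComponent.exact h) with h | ⟨_, h⟩ | ⟨h, _⟩
      · exact ConnectedComponent.sound h
      · exact absurd (ConnectedComponent.sound h).symm hb
      · exact absurd (ConnectedComponent.sound h) ha
  have := Nat.card_le_card_of_injective g hg
  rwa [Finite.card_option] at this

/-- A discrete intermediate value theorem: deleting edges one at a time raises the number of
components by at most one, so no value is skipped. It trims oversized splits to an exact separation
degree. -/
lemma exists_subset_numComp_eq [Finite V] [DecidableEq V] (G : SimpleGraph V)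
    (T : Finset (Sym2 V)) {n : ℕ} (h₁ : numComp G ≤ n) (h₂ : n ≤ numComp (remove G T)) :
    ∃ T' ⊆ T, numComp (remove G T') = n := by
  induction T using Finset.induction_on with
  | empty => exact ⟨∅, subset_rfl, le_antisymm (by rwa [remove_empty]) h₂⟩
  | insert e T _ ih =>
    by_cases h : n ≤ numComp (remove G T)
    · obtain ⟨T', hT', h'⟩ := ih h
      exact ⟨T', hT'.trans (Finset.subset_insert _ _), h'⟩
    · exact ⟨_, subset_rfl, le_antisymm
        ((numComp_remove_insert G e T).trans (Nat.succ_le_of_lt (not_le.1 h))) h₂⟩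

end Components

/-! ### Stable subgraphs, cores and prices -/

section Prices

open Classical in
/-- The largest `τ ∈ Θ` with property `P`, and `0` if there is none. -/
noncomputable def maxLevel (Θ : Finset ℝ) (P : ℝ → Prop) : ℝ :=
  if h : (Θ.filter P).Nonempty then (Θ.filter P).max' h else 0

lemma le_maxLevel {Θ : Finset ℝ} {P : ℝ → Prop} {τ : ℝ} (hτ : τ ∈ Θ) (h : P τ) :
    τ ≤ maxLevel Θ P := by
  classical
  have hm : τ ∈ Θ.filter P := Finset.mem_filter.2 ⟨hτ, h⟩
  rw [maxLevel, dif_pos ⟨τ, hm⟩]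
  exact Finset.le_max' _ _ hm

lemma maxLevel_cases (Θ : Finset ℝ) (P : ℝ → Prop) :
    maxLevel Θ P = 0 ∨ (maxLevel Θ P ∈ Θ ∧ P (maxLevel Θ P)) := by
  classical
  by_cases h : (Θ.filter P).Nonempty
  · right
    rw [maxLevel, dif_pos h]
    exact Finset.mem_filter.1 (Finset.max'_mem _ h)
  · left
    rw [maxLevel, dif_neg h]

lemma maxLevel_nonneg {Θ : Finset ℝ} {P : ℝ → Prop} (hΘ : ∀ τ ∈ Θ, 0 ≤ τ) :
    0 ≤ maxLevel Θ P := by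
  rcases maxLevel_cases Θ P with h | h
  · exact h.ge
  · exact hΘ _ h.1

variable {I : Type*}

/-- `v` is counted in `X` if its component has at least three vertices or `v` is not the least
vertex of its component. -/
def Counted [LT I] (X : SimpleGraph I) (v : I) : Prop :=
  (∃ j, j < v ∧ X.Reachable v j) ∨
    ∃ j z, X.Reachable v j ∧ X.Reachable v z ∧ v ≠ j ∧ v ≠ z ∧ j ≠ z

lemma Counted.mono [LT I] {X Y : SimpleGraph I} (h : X ≤ Y) {v : I} (hv : Counted X v) :
    Counted Y v := by
  rcases hv with ⟨j, hj, hr⟩ | ⟨j, z, h1, h2, h3⟩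
  · exact Or.inl ⟨j, hj, hr.mono h⟩
  · exact Or.inr ⟨j, z, h1.mono h, h2.mono h, h3⟩

lemma Counted.exists_adj [LinearOrder I] {X : SimpleGraph I} {v : I} (hv : Counted X v) :
    ∃ j, X.Adj v j := by
  obtain ⟨j, hr, hne⟩ : ∃ j, X.Reachable v j ∧ v ≠ j := by
    rcases hv with ⟨j, hj, hr⟩ | ⟨j, z, h1, h2, h3, _⟩
    · exact ⟨j, hr, hj.ne'⟩
    · exact ⟨j, h1, h3⟩
  obtain ⟨z, hz⟩ := hr.nonempty_neighborSet_left hne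
  exact ⟨z, hz⟩

/-- `X` has a component with at least three vertices. -/
def HasCherry (X : SimpleGraph I) : Prop := ∃ i j z, X.Adj i j ∧ X.Adj j z ∧ z ≠ i

lemma HasCherry.mono {X Y : SimpleGraph I} (h : X ≤ Y) (hX : HasCherry X) : HasCherry Y := by
  obtain ⟨i, j, z, h1, h2, h3⟩ := hX
  exact ⟨i, j, z, h h1, h h2, h3⟩

-- Each component has at most one uncounted vertex, its least one, and a component with three
-- vertices has none. The latter is the source of the extra unit.
open Classical in
lemma card_le_card_counted_add [LinearOrder I] [Fintype I] (X : SimpleGraph I) :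
    Fintype.card I + (if HasCherry X then 1 else 0) ≤
      (Finset.univ.filter (Counted X)).card + numComp X := by
  set U := Finset.univ.filter fun v => ¬ Counted X v
  have hmin : ∀ v, ¬ Counted X v → ∀ j, X.Reachable v j → v ≤ j := fun v hv j hj =>
    not_lt.1 fun h => hv (Or.inl ⟨j, h, hj⟩)
  have hinj : Set.InjOn X.connectedComponentMk U := by
    intro u hu v hv huv
    have hu' := (Finset.mem_filter.1 hu).2
    have hv' := (Finset.mem_filter.1 hv).2
    have hr := ConnectedComponent.exact huv
    exact le_antisymm (hmin u hu' v hr) (hmin v hv' u hr.symm)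
  have hU : U.card + (if HasCherry X then 1 else 0) ≤ numComp X := by
    rw [← Finset.card_image_of_injOn hinj, numComp, Nat.card_eq_fintype_card]
    split_ifs with hc
    · obtain ⟨i, j, z, h1, h2, h3⟩ := hc
      refine Nat.succ_le_of_lt (Finset.card_lt_univ_of_notMem (x := X.connectedComponentMk j) ?_)
      intro hm
      obtain ⟨v, hv, hvj⟩ := Finset.mem_image.1 hm
      have hv' := (Finset.mem_filter.1 hv).2
      have hrj := ConnectedComponent.exact hvj
      have hri := hrj.trans h1.symm.reachable
      have hrz := hrj.trans h2.reachable
      by_cases hvi : v = i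
      · exact hv' (Or.inr ⟨j, z, hrj, hrz, hvi ▸ h1.ne, hvi ▸ h3.symm, h2.ne⟩)
      · by_cases hvz : v = z
        · exact hv' (Or.inr ⟨j, i, hrj, hri, hvz ▸ h2.ne', hvi, h1.ne'⟩)
        · exact hv' (Or.inr ⟨i, z, hri, hrz, hvi, hvz, h3.symm⟩)
    · simpa using Finset.card_le_univ _
  have hsum : (Finset.univ.filter (Counted X)).card + U.card = Fintype.card I := by
    simpa using Finset.card_filter_add_card_filter_not (s := (Finset.univ : Finset I)) (Counted X)
  omega

variable [Fintype I]

open Classical in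
/-- The weighted degree of `i` in `X`. -/
noncomputable def wdeg (a : I → I → ℝ) (X : SimpleGraph I) (i : I) : ℝ :=
  ∑ j, if X.Adj i j then a i j else 0

/-- In `X`, isolating a vertex, or both ends of an edge whose component has a third vertex,
has density at least `τ`. -/
structure Stable (a : I → I → ℝ) (X : SimpleGraph I) (τ : ℝ) : Prop where
  single : ∀ i j, X.Adj i j → τ ≤ wdeg a X i
  pair : ∀ i j z, X.Adj i j → z ≠ i → z ≠ j → X.Adj i z ∨ X.Adj j z →
    2 * τ ≤ wdeg a X i + wdeg a X j - a i j

/-- The union of all `τ`-stable subgraphs of `Q`. -/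
def core (a : I → I → ℝ) (Q : SimpleGraph I) (τ : ℝ) : SimpleGraph I where
  Adj i j := ∃ X ≤ Q, Stable a X τ ∧ X.Adj i j
  symm := ⟨fun _ _ ⟨X, h1, h2, h3⟩ => ⟨X, h1, h2, h3.symm⟩⟩
  loopless := ⟨fun _ ⟨_, _, _, h3⟩ => h3.ne rfl⟩

variable {a : I → I → ℝ} {Q X Y : SimpleGraph I} {τ σ : ℝ}

lemma Stable.le_core (hX : X ≤ Q) (h : Stable a X τ) : X ≤ core a Q τ :=
  fun _ _ hij => ⟨X, hX, h, hij⟩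

lemma core_le : core a Q τ ≤ Q := fun _ _ ⟨_, h1, _, h3⟩ => h1 h3

lemma Stable.anti (h : Stable a X τ) (hσ : σ ≤ τ) : Stable a X σ :=
  ⟨fun i j hij => hσ.trans (h.single i j hij), fun i j z h1 h2 h3 h4 =>
    le_trans (by linarith) (h.pair i j z h1 h2 h3 h4)⟩

lemma core_anti (hσ : σ ≤ τ) : core a Q τ ≤ core a Q σ :=
  fun _ _ ⟨X, h1, h2, h3⟩ => ⟨X, h1, h2.anti hσ, h3⟩

section Nonneg

variable (ha : ∀ i j, 0 ≤ a i j)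
include ha

lemma wdeg_mono (h : X ≤ Y) (i : I) : wdeg a X i ≤ wdeg a Y i := by
  classical
  refine Finset.sum_le_sum fun j _ => ?_
  by_cases hx : X.Adj i j
  · simp [hx, h hx]
  · rw [if_neg hx]
    split_ifs
    exacts [ha i j, le_rfl]

lemma wdeg_nonneg (i : I) : 0 ≤ wdeg a X i := by
  classical
  refine Finset.sum_nonneg fun j _ => ?_
  split_ifs
  exacts [ha i j, le_rfl]

lemma le_wdeg {i j : I} (h : X.Adj i j) : a i j ≤ wdeg a X i := by
  classical
  have := Finset.single_le_sum (f := fun j => if X.Adj i j then a i j else 0)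
    (fun j _ => by split_ifs; exacts [ha i j, le_rfl]) (Finset.mem_univ j)
  simp only [h, if_true] at this
  exact this

lemma add_wdeg_le (h : X ≤ Y) {i j : I} (hY : Y.Adj i j) (hX : ¬ X.Adj i j) :
    a i j + wdeg a X i ≤ wdeg a Y i := by
  classical
  have : a i j = ∑ z, if z = j then a i z else 0 := by simp
  rw [this, wdeg, wdeg, ← Finset.sum_add_distrib]
  refine Finset.sum_le_sum fun z _ => ?_
  by_cases hz : z = j
  · subst hz
    simp [hX, hY]
  · by_cases hx : X.Adj i z
    · simp [hx, h hx, hz]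
    · rw [if_neg hz, if_neg hx]
      split_ifs
      · simpa using ha i z
      · simp

variable (hs : ∀ i j, a i j = a j i)
include hs

/-- Degrees only grow in a union, so the work is the pair condition for `ij` in `X` and `iz` in `Y`.
If `ij` is in `Y`, use `Y`. Otherwise `ij` comes on top of the degree of `i` in `Y`, which is at
least `τ`, while the degree of `j` is at least `τ` because of `X`. -/
lemma Stable.core : Stable a (core a Q τ) τ := by
  have key : ∀ i j z, (∃ X ≤ Q, Stable a X τ ∧ X.Adj i j) → z ≠ j → (KCut.core a Q τ).Adj i z →
      2 * τ ≤ wdeg a (KCut.core a Q τ) i + wdeg a (KCut.core a Q τ) j - a i j := by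
    rintro i j z ⟨X, hXQ, hX, hij⟩ hzj ⟨Y, hYQ, hY, hiz⟩
    have hXc := hX.le_core hXQ
    have hYc := hY.le_core hYQ
    by_cases hYij : Y.Adj i j
    · have := hY.pair i j z hYij hiz.ne' hzj (Or.inl hiz)
      have h1 := wdeg_mono ha hYc i
      have h2 := wdeg_mono ha hYc j
      linarith
    · have h1 := add_wdeg_le ha hYc (hXc hij) hYij
      have h2 := hY.single i z hiz
      have h3 := wdeg_mono ha hXc j
      have h4 := hX.single j i hij.symm
      linarith
  refine ⟨?_, ?_⟩
  · rintro i j ⟨X, hXQ, hX, hij⟩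
    exact (hX.single i j hij).trans (wdeg_mono ha (hX.le_core hXQ) i)
  · rintro i j z hij hzi hzj (h | h)
    · exact key i j z hij hzj h
    · have := key j i z hij.symm hzi h
      rw [hs j i] at this
      linarith

end Nonneg

/-- The largest threshold at which `v` is not isolated in the core. -/
noncomputable def coreLevel (a : I → I → ℝ) (Q : SimpleGraph I) (Θ : Finset ℝ) (v : I) : ℝ :=
  maxLevel Θ fun τ => ∃ j, (core a Q τ).Adj v j

variable [LinearOrder I]

/-- The largest threshold at which `v` is counted in the core. -/
noncomputable def price (a : I → I → ℝ) (Q : SimpleGraph I) (Θ : Finset ℝ) (v : I) : ℝ :=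
  maxLevel Θ fun τ => Counted (core a Q τ) v

variable {Θ : Finset ℝ}

lemma le_price (hX : X ≤ Q) (h : Stable a X τ) (hτ : τ ∈ Θ) {v : I} (hv : Counted X v) :
    τ ≤ price a Q Θ v :=
  le_maxLevel hτ (hv.mono (h.le_core hX))

lemma price_le_coreLevel (hΘ : ∀ τ ∈ Θ, 0 ≤ τ) (v : I) : price a Q Θ v ≤ coreLevel a Q Θ v := by
  rcases maxLevel_cases Θ fun τ => Counted (core a Q τ) v with h | ⟨h1, h2⟩
  · rw [price, h]
    exact maxLevel_nonneg hΘ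
  · exact le_maxLevel h1 h2.exists_adj

end Prices

/-! ### Level edges and the saving along one of them -/

section LevelGraph

variable {I : Type*} [Fintype I] {a : I → I → ℝ} {Q : SimpleGraph I} {Θ : Finset ℝ}

/-- The edges whose level agrees with the core levels of both ends. -/
def levelGraph (a : I → I → ℝ) (Q : SimpleGraph I) (Θ : Finset ℝ) : SimpleGraph I where
  Adj i j := (core a Q (coreLevel a Q Θ i)).Adj i j ∧ (core a Q (coreLevel a Q Θ j)).Adj i j
  symm := ⟨fun _ _ h => ⟨h.2.symm, h.1.symm⟩⟩
  loopless := ⟨fun _ h => h.1.ne rfl⟩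

open Classical in
/-- The weight at `i` of the edges outside the level graph. -/
noncomputable def offLevel (a : I → I → ℝ) (Q : SimpleGraph I) (Θ : Finset ℝ) (i : I) : ℝ :=
  ∑ j, if (levelGraph a Q Θ).Adj i j then 0 else a i j

/-- The weighted degree of `i` in the last core that contains it. -/
noncomputable def coreDeg (a : I → I → ℝ) (Q : SimpleGraph I) (Θ : Finset ℝ) (i : I) : ℝ :=
  wdeg a (core a Q (coreLevel a Q Θ i)) i

lemma coreLevel_nonneg (hΘ : ∀ τ ∈ Θ, 0 ≤ τ) (i : I) : 0 ≤ coreLevel a Q Θ i :=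
  maxLevel_nonneg hΘ

lemma coreLevel_mem (h0 : 0 ∈ Θ) (i : I) : coreLevel a Q Θ i ∈ Θ := by
  rcases maxLevel_cases Θ fun τ => ∃ j, (core a Q τ).Adj i j with h | h
  · rwa [coreLevel, h]
  · exact h.1

/-- A neighbour of `i` in the core at the level of `i` is not isolated there. Used from both ends of
a level edge, this makes their levels equal. -/
lemma coreLevel_le_of_adj (h0 : 0 ∈ Θ) {i j : I}
    (h : (core a Q (coreLevel a Q Θ i)).Adj i j) : coreLevel a Q Θ i ≤ coreLevel a Q Θ j :=
  le_maxLevel (coreLevel_mem h0 i) ⟨i, h.symm⟩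

lemma coreLevel_eq_of_adj (h0 : 0 ∈ Θ) {i j : I} (h : (levelGraph a Q Θ).Adj i j) :
    coreLevel a Q Θ i = coreLevel a Q Θ j :=
  le_antisymm (coreLevel_le_of_adj h0 h.1) (coreLevel_le_of_adj h0 h.2.symm)

variable (ha : ∀ i j, 0 ≤ a i j) (hs : ∀ i j, a i j = a j i) (hΘ : ∀ τ ∈ Θ, 0 ≤ τ)

include ha hs in
lemma coreLevel_le_coreDeg (i : I) : coreLevel a Q Θ i ≤ coreDeg a Q Θ i := by
  rcases maxLevel_cases Θ fun τ => ∃ j, (core a Q τ).Adj i j with h | ⟨_, j, hj⟩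
  · exact (show coreLevel a Q Θ i = 0 from h).trans_le (wdeg_nonneg ha i)
  · exact (Stable.core ha hs).single i j hj

include ha in
lemma offLevel_nonneg (i : I) : 0 ≤ offLevel a Q Θ i := by
  refine Finset.sum_nonneg fun j _ => ?_
  split_ifs
  exacts [le_rfl, ha i j]

include ha in
lemma wdeg_le_add_offLevel {i j : I} (X : SimpleGraph I)
    (h : ∀ z, (levelGraph a Q Θ).Adj i z → z = j) : wdeg a X i ≤ a i j + offLevel a Q Θ i := by
  classical
  have : a i j = ∑ z, if z = j then a i z else 0 := by simp
  rw [this, wdeg, offLevel, ← Finset.sum_add_distrib]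
  refine Finset.sum_le_sum fun z _ => ?_
  by_cases hz : z = j
  · subst hz
    rw [if_pos rfl]
    split_ifs <;> simp [ha i z]
  · have hT : ¬ (levelGraph a Q Θ).Adj i z := fun hT => hz (h z hT)
    rw [if_neg hz, if_neg hT]
    split_ifs <;> simp [ha i z]

variable [LinearOrder I]

-- If the component of `ij` in the core at the common level has a third vertex, the pair condition
-- saves all of `a i j`. Otherwise `ij` is a whole component, and its lesser end `i` does not count
-- there. So if the price of `i` is not 0, it is a threshold at which `i` or `j` has a further
-- neighbour. The pair condition at that threshold bounds the price by half of `a i j` plus half of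
-- the off-level weight at both ends.
include ha hs hΘ in
lemma price_add_price_le_aux (h0 : 0 ∈ Θ) {i j : I} (hij : i < j) (h : (levelGraph a Q Θ).Adj i j) :
    price a Q Θ i + price a Q Θ j ≤ coreDeg a Q Θ i + coreDeg a Q Θ j - a i j / 2
      + (offLevel a Q Θ i + offLevel a Q Θ j) / 2 := by
  have hceq := coreLevel_eq_of_adj h0 h
  have hci := price_le_coreLevel (a := a) (Q := Q) hΘ i
  have hcj := price_le_coreLevel (a := a) (Q := Q) hΘ j
  have hNi := offLevel_nonneg (Q := Q) (Θ := Θ) ha i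
  have hNj := offLevel_nonneg (Q := Q) (Θ := Θ) ha j
  have haij := ha i j
  have hcoreDeg : coreDeg a Q Θ j = wdeg a (core a Q (coreLevel a Q Θ i)) j := by
    rw [coreDeg, hceq]
  have hst : Stable a (core a Q (coreLevel a Q Θ i)) (coreLevel a Q Θ i) := Stable.core ha hs
  by_cases hz : ∃ z, z ≠ i ∧ z ≠ j ∧ ((core a Q (coreLevel a Q Θ i)).Adj i z ∨
      (core a Q (coreLevel a Q Θ i)).Adj j z)
  · obtain ⟨z, hzi, hzj, hz⟩ := hz
    have := hst.pair i j z h.1 hzi hzj hz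
    rw [hcoreDeg]
    have hD : coreDeg a Q Θ i = wdeg a (core a Q (coreLevel a Q Θ i)) i := rfl
    linarith
  · push Not at hz
    have hTi : ∀ z, (levelGraph a Q Θ).Adj i z → z = j := by
      intro z hT
      by_contra hne
      exact (hz z hT.ne' hne).1 hT.1
    have hTj : ∀ z, (levelGraph a Q Θ).Adj j z → z = i := by
      intro z hT
      by_contra hne
      exact (hz z hne hT.ne').2 (hceq ▸ hT.1)
    have hdi : a i j ≤ coreDeg a Q Θ i := le_wdeg ha h.1
    have hdj : a i j ≤ coreDeg a Q Θ j := by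
      rw [hs i j]
      exact le_wdeg ha h.2.symm
    have hcd := coreLevel_le_coreDeg (Q := Q) (Θ := Θ) ha hs j
    have hpi : 2 * price a Q Θ i ≤ a i j + offLevel a Q Θ i + offLevel a Q Θ j := by
      rcases maxLevel_cases Θ fun τ => Counted (core a Q τ) i with h' | ⟨hm, hc⟩
      · have h' : price a Q Θ i = 0 := h'
        linarith
      · change Counted (core a Q (price a Q Θ i)) i at hc
        have hle := core_anti (a := a) (Q := Q) hci
        have hreach : ∀ X : SimpleGraph I, (∀ z, X.Adj i z → z = j) → (∀ z, X.Adj j z → z = i) →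
            ¬ Counted X i := by
          intro X h1 h2 hX
          have hr : ∀ z, X.Reachable i z → z = i ∨ z = j := by
            intro z hz
            have := eq_of_reachable_of_adj (G := X) (g := fun z => z = i ∨ z = j) (fun x y hxy => by
              apply propext
              constructor
              · rintro (rfl | rfl)
                · exact Or.inr (h1 _ hxy)
                · exact Or.inl (h2 _ hxy)
              · rintro (rfl | rfl)
                · exact Or.inr (h1 _ hxy.symm)
                · exact Or.inl (h2 _ hxy.symm)) hz
            exact this.mp (Or.inl rfl)
          rcases hX with ⟨z, hzi, hz⟩ | ⟨z, w, hz, hw, h3, h4, h5⟩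
          · rcases hr z hz with rfl | rfl
            · exact lt_irrefl _ hzi
            · exact lt_asymm hij hzi
          · rcases hr z hz with rfl | rfl
            · exact h3 rfl
            · rcases hr w hw with rfl | rfl
              · exact h4 rfl
              · exact h5 rfl
        obtain ⟨z, hzi, hzj, hzadj⟩ : ∃ z, z ≠ i ∧ z ≠ j ∧ ((core a Q (price a Q Θ i)).Adj i z ∨
            (core a Q (price a Q Θ i)).Adj j z) := by
          by_contra hno
          push Not at hno
          refine hreach _ (fun z hz => ?_) (fun z hz => ?_) hc
          · by_contra hne
            exact (hno z hz.ne' hne).1 hz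
          · by_contra hne
            exact (hno z hne hz.ne').2 hz
        have := (Stable.core ha hs).pair i j z (hle h.1) hzi hzj hzadj
        have h1 := wdeg_le_add_offLevel ha (core a Q (price a Q Θ i)) hTi
        have h2 := wdeg_le_add_offLevel ha (core a Q (price a Q Θ i)) hTj
        rw [hs j i] at h2
        linarith
    have hDi : coreDeg a Q Θ i = a i j := by
      refine le_antisymm ?_ hdi
      have : a i j = ∑ z, if z = j then a i z else 0 := by simp
      rw [this]
      refine Finset.sum_le_sum fun z _ => ?_
      by_cases hzj : z = j
      · subst hzj
        simp [h.1]
      · have : ¬ (core a Q (coreLevel a Q Θ i)).Adj i z := fun hadj =>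
          (hz z hadj.ne' hzj).1 hadj
        simp [this, hzj]
    linarith

include ha hs hΘ in
lemma price_add_price_le (h0 : 0 ∈ Θ) {i j : I} (h : (levelGraph a Q Θ).Adj i j) :
    price a Q Θ i + price a Q Θ j ≤ coreDeg a Q Θ i + coreDeg a Q Θ j - a i j / 2
      + (offLevel a Q Θ i + offLevel a Q Θ j) / 2 := by
  rcases lt_or_gt_of_ne h.ne with hij | hij
  · exact price_add_price_le_aux ha hs hΘ h0 hij h
  · have := price_add_price_le_aux ha hs hΘ h0 hij h.symm
    rw [hs j i] at this
    linarith

end LevelGraph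

/-! ### Bounding the sum of the prices -/

section PriceSum

variable {I : Type*} [Fintype I] {a : I → I → ℝ} {Q : SimpleGraph I} {Θ : Finset ℝ}
variable (ha : ∀ i j, 0 ≤ a i j) (hs : ∀ i j, a i j = a j i) (hΘ : ∀ τ ∈ Θ, 0 ≤ τ)

-- An edge enters the degree sum once for each end in `L` whose last core contains it. It enters
-- twice only if it is a level edge with both ends in `L`.
include ha hs in
open Classical in
lemma sum_coreDeg_le (L : I → Prop) :
    2 * ∑ i, (if L i then coreDeg a Q Θ i else 0) ≤ ∑ i, ∑ j, a i j +
      ∑ i, ∑ j, if (levelGraph a Q Θ).Adj i j ∧ L i ∧ L j then a i j else 0 := by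
  set χ : I → I → ℝ := fun i j =>
    if L i ∧ (core a Q (coreLevel a Q Θ i)).Adj i j then a i j else 0
  have h1 : ∑ i, (if L i then coreDeg a Q Θ i else 0) = ∑ i, ∑ j, χ i j := by
    refine Finset.sum_congr rfl fun i _ => ?_
    by_cases hL : L i
    · simp [χ, hL, coreDeg, wdeg]
    · simp [χ, hL]
  have h2 : ∑ i, ∑ j, χ i j = ∑ i, ∑ j, χ j i := Finset.sum_comm
  calc 2 * ∑ i, (if L i then coreDeg a Q Θ i else 0)
      = ∑ i, ∑ j, (χ i j + χ j i) := by
        simp only [Finset.sum_add_distrib]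
        rw [h1, ← h2, two_mul]
    _ ≤ ∑ i, ∑ j, (a i j +
          if (levelGraph a Q Θ).Adj i j ∧ L i ∧ L j then a i j else 0) := by
        refine Finset.sum_le_sum fun i _ => Finset.sum_le_sum fun j _ => ?_
        have hij := ha i j
        simp only [χ, hs j i]
        by_cases h1 : L i ∧ (core a Q (coreLevel a Q Θ i)).Adj i j <;>
          by_cases h2 : L j ∧ (core a Q (coreLevel a Q Θ j)).Adj j i
        · rw [if_pos h1, if_pos h2, if_pos ⟨⟨h1.2, h2.2.symm⟩, h1.1, h2.1⟩]
        all_goals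
          simp only [h1, h2, if_false]
          split_ifs <;> linarith
    _ = _ := by simp only [Finset.sum_add_distrib]

variable [LinearOrder I]

-- Without the matching term, core degrees plus a quarter of the off-level weight already sum to at
-- most the total weight. The matching then collects the saving of each level edge. Row sums up to
-- 1/2 are allowed because the off-level error is halved in `g`, which leaves exactly the quarter
-- that can be absorbed.
include ha hs hΘ in
lemma sum_price_le_of_matching (h0 : 0 ∈ Θ) (y : I → I → ℝ) (hy : ∀ i j, 0 ≤ y i j)
    (hys : ∀ i j, y i j = y j i) (hyT : ∀ i j, y i j ≠ 0 → (levelGraph a Q Θ).Adj i j)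
    (hY : ∀ i, ∑ j, y i j ≤ 1 / 2) :
    ∑ i, price a Q Θ i ≤ ∑ i, ∑ j, a i j - (∑ i, ∑ j, y i j * a i j) / 4 := by
  classical
  set g : I → ℝ := fun i => price a Q Θ i - coreDeg a Q Θ i - offLevel a Q Θ i / 2
  have hA : ∑ i, ∑ j, y i j * g j = ∑ i, ∑ j, y i j * g i := by
    rw [Finset.sum_comm]
    exact Finset.sum_congr rfl fun i _ => Finset.sum_congr rfl fun j _ => by rw [hys]
  have hA2 : ∑ i, ∑ j, (y i j * g i + y i j * g j) ≤ ∑ i, ∑ j, -(1 / 2) * (y i j * a i j) := by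
    refine Finset.sum_le_sum fun i _ => Finset.sum_le_sum fun j _ => ?_
    by_cases h : y i j = 0
    · simp [h]
    · have := mul_le_mul_of_nonneg_left
        (price_add_price_le ha hs hΘ h0 (hyT i j h)) (hy i j)
      simp only [g]
      linarith
  simp only [Finset.sum_add_distrib, ← Finset.mul_sum] at hA2
  have hi : ∀ i, price a Q Θ i ≤ coreDeg a Q Θ i + (∑ j, y i j * g i) + offLevel a Q Θ i / 4 := by
    intro i
    have h1 := (price_le_coreLevel hΘ i).trans (coreLevel_le_coreDeg (Q := Q) (Θ := Θ) ha hs i)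
    have h2 := offLevel_nonneg (Q := Q) (Θ := Θ) ha i
    rw [← Finset.sum_mul]
    have h3 := mul_nonneg (sub_nonneg.2 (hY i)) h2
    have h4 := mul_nonneg (sub_nonneg.2 (hY i)) (sub_nonneg.2 h1)
    simp only [g]
    nlinarith
  have hsum := Finset.sum_le_sum fun i (_ : i ∈ Finset.univ) => hi i
  simp only [Finset.sum_add_distrib, ← Finset.sum_div] at hsum
  have hD := sum_coreDeg_le (Q := Q) (Θ := Θ) ha hs fun _ => True
  simp only [if_true, and_true] at hD
  have hN : ∑ i, offLevel a Q Θ i +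
      ∑ i, ∑ j, (if (levelGraph a Q Θ).Adj i j then a i j else 0) = ∑ i, ∑ j, a i j := by
    simp only [offLevel, ← Finset.sum_add_distrib]
    refine Finset.sum_congr rfl fun i _ => Finset.sum_congr rfl fun j _ => ?_
    split_ifs <;> simp
  have hN0 : 0 ≤ ∑ i, offLevel a Q Θ i :=
    Finset.sum_nonneg fun i _ => offLevel_nonneg ha i
  simp only [← Finset.sum_mul] at *
  linarith

open Classical in
include ha hs hΘ in
/-- The prices of a sparse weighted graph sum to less than twice its total weight. -/
theorem sum_price_le (h0 : 0 ∈ Θ) {c : ℕ} (hc : 1 ≤ c)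
    (hQ : ∀ s : Finset I, ∑ i ∈ s, (s.filter (Q.Adj i)).card ≤ 2 * c * s.card) :
    ∑ i, price a Q Θ i ≤ (1 - 1 / (140 * c)) * ∑ i, ∑ j, a i j := by
  set T := levelGraph a Q Θ
  set L : I → Prop := fun i => (Finset.univ.filter (T.Adj i)).card ≤ 8 * c
  have hc' : (1 : ℝ) ≤ c := by exact_mod_cast hc
  set WL := ∑ i, ∑ j, if T.Adj i j ∧ L i ∧ L j then a i j else 0
  set W := ∑ i, ∑ j, a i j
  have hW0 : 0 ≤ W := Finset.sum_nonneg fun i _ => Finset.sum_nonneg fun j _ => ha i j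
  -- The uniform matching on level edges between low vertices: at most `8c` edges of weight `1 /
  -- (16c)` at each vertex give row sums at most 1/2.
  have hA : ∑ i, price a Q Θ i ≤ W - 1 / (16 * c) * WL / 4 := by
    have := sum_price_le_of_matching (Q := Q) ha hs hΘ h0
      (fun i j => if T.Adj i j ∧ L i ∧ L j then 1 / (16 * (c : ℝ)) else 0) ?_ ?_ ?_ ?_
    · refine this.trans_eq ?_
      congr 2
      simp only [WL, Finset.mul_sum]
      refine Finset.sum_congr rfl fun i _ => Finset.sum_congr rfl fun j _ => ?_
      split_ifs <;> simp
    · intro i j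
      split_ifs <;> positivity
    · intro i j
      simp only [T.adj_comm i j, and_comm (a := L i)]
    · intro i j h
      by_contra hT
      exact h (if_neg fun h' => hT h'.1)
    · intro i
      by_cases hL : L i
      · have h1 : ∀ j ∈ Finset.univ, (if T.Adj i j ∧ L i ∧ L j then 1 / (16 * (c : ℝ)) else 0) ≤
            if T.Adj i j then 1 / (16 * (c : ℝ)) else 0 := by
          intro j _
          by_cases hT : T.Adj i j
          · simp only [hT, hL, true_and, if_true]
            split_ifs
            · exact le_rfl
            · positivity
          · simp [hT]
        refine (Finset.sum_le_sum h1).trans ?_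
        rw [← Finset.sum_filter, Finset.sum_const, nsmul_eq_mul]
        have h2 : ((Finset.univ.filter (T.Adj i)).card : ℝ) ≤ 8 * c := by exact_mod_cast hL
        rw [mul_one_div, div_le_iff₀ (by positivity)]
        linarith
      · simp [hL]
  -- Level neighbours lie in the same level class, where the average degree in `Q` is at most `2c`.
  -- By Markov at most a quarter of the class has level degree above `8c`. Dropping these vertices
  -- costs a factor 4/3, as all levels in the class are equal.
  have hB : ∑ i, price a Q Θ i ≤ 2 / 3 * (W + WL) := by
    have hlev : ∀ τ ∈ Finset.univ.image (coreLevel a Q Θ),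
        ∑ i ∈ Finset.univ.filter (fun i => coreLevel a Q Θ i = τ), coreLevel a Q Θ i ≤
        4 / 3 * ∑ i ∈ Finset.univ.filter (fun i => coreLevel a Q Θ i = τ),
          if L i then coreLevel a Q Θ i else 0 := by
      intro τ hτ
      obtain ⟨i₀, _, rfl⟩ := Finset.mem_image.1 hτ
      set s := Finset.univ.filter (fun i => coreLevel a Q Θ i = coreLevel a Q Θ i₀)
      have hmem : ∀ i ∈ s, coreLevel a Q Θ i = coreLevel a Q Θ i₀ := fun i hi =>
        (Finset.mem_filter.1 hi).2
      rw [← Finset.sum_filter, Finset.sum_congr rfl hmem,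
        Finset.sum_congr rfl fun i hi => hmem i (Finset.mem_filter.1 hi).1, Finset.sum_const,
        Finset.sum_const, nsmul_eq_mul, nsmul_eq_mul]
      have hdeg : ∀ i ∈ s, (Finset.univ.filter (T.Adj i)).card ≤ (s.filter (Q.Adj i)).card := by
        intro i hi
        refine Finset.card_le_card fun j hj => ?_
        have hj := (Finset.mem_filter.1 hj).2
        refine Finset.mem_filter.2 ⟨Finset.mem_filter.2 ⟨Finset.mem_univ _, ?_⟩, core_le hj.1⟩
        rw [← coreLevel_eq_of_adj h0 hj, hmem i hi]
      have hhigh : (s.filter fun i => ¬ L i).card * (8 * c + 1) ≤ 2 * c * s.card := by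
        refine le_trans ?_ (hQ s)
        rw [← smul_eq_mul, ← Finset.sum_const]
        refine (Finset.sum_le_sum fun i hi => ?_).trans
          (Finset.sum_le_sum_of_subset (Finset.filter_subset (fun i => ¬ L i) s))
        obtain ⟨h1, h2⟩ := Finset.mem_filter.1 hi
        exact (Nat.succ_le_of_lt (not_le.1 h2)).trans (hdeg i h1)
      have hadd := Finset.card_filter_add_card_filter_not (s := s) L
      have h4 : 4 * (s.filter fun i => ¬ L i).card ≤ s.card := by
        by_contra hlt
        push Not at hlt
        have := Nat.mul_lt_mul_of_pos_left hlt (show 0 < 2 * c by omega)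
        nlinarith
      have h5 : (s.card : ℝ) ≤ 4 / 3 * (s.filter L).card := by
        have : 3 * s.card ≤ 4 * (s.filter L).card := by omega
        have : (3 : ℝ) * s.card ≤ 4 * (s.filter L).card := by exact_mod_cast this
        linarith
      have := mul_le_mul_of_nonneg_right h5 (coreLevel_nonneg (a := a) (Q := Q) hΘ i₀)
      linarith
    have hsum := Finset.sum_le_sum hlev
    rw [← Finset.mul_sum, Finset.sum_fiberwise_of_maps_to
      (fun i _ => Finset.mem_image_of_mem _ (Finset.mem_univ i)), Finset.sum_fiberwise_of_maps_to
      (fun i _ => Finset.mem_image_of_mem _ (Finset.mem_univ i))] at hsum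
    have h1 : ∑ i, price a Q Θ i ≤ ∑ i, coreLevel a Q Θ i :=
      Finset.sum_le_sum fun i _ => price_le_coreLevel hΘ i
    have h2 : ∑ i, (if L i then coreLevel a Q Θ i else 0) ≤
        ∑ i, if L i then coreDeg a Q Θ i else 0 := by
      refine Finset.sum_le_sum fun i _ => ?_
      split_ifs
      exacts [coreLevel_le_coreDeg ha hs i, le_rfl]
    have h3 : 2 * ∑ i, (if L i then coreDeg a Q Θ i else 0) ≤ W + WL := by
      convert sum_coreDeg_le (Q := Q) (Θ := Θ) ha hs L
    linarith
  have hcpos : (0 : ℝ) < c := by linarith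
  -- At the threshold 16/35 the first bound saves `(16/35) / (64c) = 1 / (140c)`. Below it the
  -- second gives `(2/3)(51/35) = 34/35`, which suffices.
  by_cases hl : 16 / 35 * W ≤ WL
  · refine hA.trans ?_
    have : 1 / (140 * (c : ℝ)) * W ≤ 1 / (16 * c) * WL / 4 := by
      have := mul_le_mul_of_nonneg_left hl (show 0 ≤ 1 / (16 * (c : ℝ)) / 4 by positivity)
      calc 1 / (140 * (c : ℝ)) * W = 1 / (16 * (c : ℝ)) / 4 * (16 / 35 * W) := by
            field_simp
            ring
        _ ≤ _ := this
        _ = _ := by ring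
    linarith
  · refine hB.trans ?_
    have : 1 / (140 * (c : ℝ)) ≤ 1 / 140 := by
      rw [div_le_div_iff_of_pos_left one_pos (by positivity) (by positivity)]
      linarith
    have := mul_le_mul_of_nonneg_right this hW0
    push Not at hl
    linarith

end PriceSum

/-! ### The quotient by the cells and its stability -/

section Quotient

variable {V I : Type*}

/-- The simple graph on `I` induced by `F` along `f : V → I`. -/
def quot (F : SimpleGraph V) (f : V → I) : SimpleGraph I where
  Adj i j := i ≠ j ∧ ∃ x y, F.Adj x y ∧ f x = i ∧ f y = j
  symm := ⟨fun _ _ ⟨h, x, y, hxy, hx, hy⟩ => ⟨h.symm, y, x, hxy.symm, hy, hx⟩⟩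
  loopless := ⟨fun _ h => h.1 rfl⟩

lemma quot_mono {F F' : SimpleGraph V} (h : F ≤ F') (f : V → I) : quot F f ≤ quot F' f :=
  fun _ _ ⟨hne, x, y, hxy, hx, hy⟩ => ⟨hne, x, y, h hxy, hx, hy⟩

lemma numComp_quot_le [Finite V] (F : SimpleGraph V) {f : V → I} (hf : Function.Surjective f) :
    numComp (quot F f) ≤ numComp F := by
  refine numComp_le_of_surjective hf fun x y hxy => ?_
  by_cases h : f x = f y
  · rw [h]
  · exact Adj.reachable ⟨h, x, y, hxy, rfl, rfl⟩

open Classical in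
/-- The weight of the edges of `S` between two different fibres of `f`. -/
noncomputable def cellWeight (w : Sym2 V → ℝ) (S : Finset (Sym2 V)) (f : V → I) (i j : I) : ℝ :=
  if i = j then 0 else ∑ e ∈ S, if Sym2.map f e = s(i, j) then w e else 0

section Weights

variable {w : Sym2 V → ℝ} {S : Finset (Sym2 V)} {f : V → I}

lemma cellWeight_comm (i j : I) : cellWeight w S f i j = cellWeight w S f j i := by
  by_cases h : i = j
  · rw [h]
  · rw [cellWeight, cellWeight, if_neg h, if_neg (Ne.symm h), Sym2.eq_swap]

lemma cellWeight_nonneg (hw : ∀ e ∈ S, 0 ≤ w e) (i j : I) : 0 ≤ cellWeight w S f i j := by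
  rw [cellWeight]
  split_ifs
  · exact le_rfl
  · refine Finset.sum_nonneg fun e he => ?_
    split_ifs
    exacts [hw e he, le_rfl]

/-- An edge between two cells is seen once for each order of the cells, and an edge inside a cell
not at all. -/
lemma sum_cellWeight_le [Fintype I] (hw : ∀ e ∈ S, 0 ≤ w e) :
    ∑ i, ∑ j, cellWeight w S f i j ≤ 2 * weight w S := by
  classical
  have h : ∀ i j, cellWeight w S f i j =
      ∑ e ∈ S, if i ≠ j ∧ Sym2.map f e = s(i, j) then w e else 0 := by
    intro i j
    by_cases hij : i = j <;> simp [cellWeight, hij]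
  simp only [h]
  rw [weight, Finset.mul_sum, Finset.sum_congr rfl fun i _ => Finset.sum_comm, Finset.sum_comm]
  refine Finset.sum_le_sum fun e he => ?_
  induction hp : Sym2.map f e with
  | h p q =>
  have hle : ∀ i j, (if i ≠ j ∧ s(p, q) = s(i, j) then w e else 0) ≤
      (if i = p ∧ j = q then w e else 0) + if i = q ∧ j = p then w e else 0 := by
    intro i j
    have := hw e he
    by_cases h1 : i ≠ j ∧ s(p, q) = s(i, j)
    · rw [if_pos h1]
      rcases Sym2.eq_iff.1 h1.2 with ⟨rfl, rfl⟩ | ⟨rfl, rfl⟩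
      · rw [if_pos ⟨rfl, rfl⟩]
        split_ifs <;> linarith
      · rw [if_pos (c := q = q ∧ p = p) ⟨rfl, rfl⟩]
        split_ifs <;> linarith
    · rw [if_neg h1]
      split_ifs <;> linarith
  refine (Finset.sum_le_sum fun i _ => Finset.sum_le_sum fun j _ => hle i j).trans ?_
  simp only [Finset.sum_add_distrib, ite_and]
  simp [two_mul]

lemma weight_mono {T T' : Finset (Sym2 V)} (h : T' ⊆ T) (hw : ∀ e ∈ T, 0 ≤ w e) :
    weight w T' ≤ weight w T :=
  Finset.sum_le_sum_of_subset_of_nonneg h fun e he _ => hw e he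

lemma weight_union_le [DecidableEq V] {T T' : Finset (Sym2 V)} (h : ∀ e ∈ T, 0 ≤ w e) :
    weight w (T ∪ T') ≤ weight w T + weight w T' := by
  have := Finset.sum_union_inter (s₁ := T) (s₂ := T') (f := w)
  have h0 : 0 ≤ ∑ e ∈ T ∩ T', w e :=
    Finset.sum_nonneg fun e he => h e (Finset.mem_inter.1 he).1
  simp only [weight]
  linarith

end Weights

variable [Fintype V] {G F : SimpleGraph V} {w : Sym2 V → ℝ} {S : Finset (Sym2 V)} {f : V → I}

open Classical in
/-- The edges of `F` that leave the fibre over `i`. -/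
noncomputable def boundary (F : SimpleGraph V) (f : V → I) (i : I) : Finset (Sym2 V) :=
  Finset.univ.filter fun e => e ∈ F.edgeSet ∧ ∃ j, j ≠ i ∧ Sym2.map f e = s(i, j)

lemma mem_boundary {i : I} {x y : V} :
    s(x, y) ∈ boundary F f i ↔ F.Adj x y ∧ (f x = i ∧ f y ≠ i ∨ f x ≠ i ∧ f y = i) := by
  classical
  simp only [boundary, Finset.mem_filter, Finset.mem_univ, true_and, mem_edgeSet, Sym2.map_mk,
    Sym2.eq_iff]
  refine and_congr_right fun _ => ⟨?_, ?_⟩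
  · rintro ⟨j, hj, ⟨h1, h2⟩ | ⟨h1, h2⟩⟩
    · exact Or.inl ⟨h1, h2 ▸ hj⟩
    · exact Or.inr ⟨h1 ▸ hj, h2⟩
  · rintro (⟨h1, h2⟩ | ⟨h1, h2⟩)
    · exact ⟨_, h2, Or.inl ⟨h1, rfl⟩⟩
    · exact ⟨_, h1, Or.inr ⟨rfl, h2⟩⟩

lemma boundary_subset (i : I) : (boundary F f i : Set (Sym2 V)) ⊆ F.edgeSet := by
  classical
  intro e he
  simp only [boundary, Finset.coe_filter, Set.mem_ofPred_eq] at he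
  exact he.2.1

lemma numComp_remove_boundary {i : I} {x y : V} (hxy : F.Adj x y) (hx : f x = i) (hy : f y ≠ i) :
    numComp F + 1 ≤ numComp (remove F (boundary F f i)) := by
  refine numComp_lt remove_le hxy.reachable fun h => ?_
  have := eq_of_reachable_of_adj (g := fun z => f z = i) (fun a b hab => by
    rw [remove_adj, mem_boundary] at hab
    have h1 := hab.1
    have h2 := hab.2
    apply propext
    tauto) h
  exact hy (this.mp hx)

lemma weight_boundary_le [Fintype I] (hS : ∀ x y, F.Adj x y → f x ≠ f y → s(x, y) ∈ S)
    (hw : ∀ e ∈ S, 0 ≤ w e) {i : I} {J : I → Prop} [DecidablePred J]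
    (hJ : ∀ x y, F.Adj x y → f x = i → f y ≠ i → J (f y)) :
    weight w (boundary F f i) ≤ ∑ j, if J j then cellWeight w S f i j else 0 := by
  classical
  have hBS : boundary F f i ⊆ S := by
    intro e
    induction e with
    | h x y =>
      intro he
      obtain ⟨h1, h2⟩ := mem_boundary.1 he
      refine hS x y h1 ?_
      rcases h2 with ⟨h2, h3⟩ | ⟨h2, h3⟩
      · rw [h2]; exact h3.symm
      · rwa [h3]
  have key : ∀ e ∈ boundary F f i, w e ≤
      ∑ j, if J j ∧ i ≠ j ∧ Sym2.map f e = s(i, j) then w e else 0 := by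
    intro e he
    have hwe := hw e (hBS he)
    obtain ⟨j, hj, hji, hm⟩ : ∃ j, J j ∧ i ≠ j ∧ Sym2.map f e = s(i, j) := by
      induction e with
      | h x y =>
        obtain ⟨h1, ⟨h2, h3⟩ | ⟨h2, h3⟩⟩ := mem_boundary.1 he
        · exact ⟨f y, hJ x y h1 h2 h3, h3.symm, by simp [h2]⟩
        · exact ⟨f x, hJ y x h1.symm h3 h2, h2.symm, by simp [h3, Sym2.eq_swap]⟩
    refine le_trans ?_ (Finset.single_le_sum (fun j _ => ?_) (Finset.mem_univ j))
    · rw [if_pos ⟨hj, hji, hm⟩]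
    · split_ifs
      exacts [hwe, le_rfl]
  refine (Finset.sum_le_sum key).trans ?_
  refine (Finset.sum_le_sum_of_subset_of_nonneg hBS fun e he _ => ?_).trans_eq ?_
  · refine Finset.sum_nonneg fun j _ => ?_
    split_ifs
    exacts [hw e he, le_rfl]
  · rw [Finset.sum_comm]
    refine Finset.sum_congr rfl fun j _ => ?_
    by_cases hj : J j <;> by_cases hij : i = j <;> simp [hj, hij, cellWeight]

/-- If splits of `F` that add one component weigh at least `τ` and those that add two weigh at
least `2 * τ`, then the quotient of `F` is `τ`-stable. -/
lemma stable_quot [Fintype I] (hS : ∀ x y, F.Adj x y → f x ≠ f y → s(x, y) ∈ S)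
    (hw : ∀ e ∈ S, 0 ≤ w e) (hwF : ∀ e ∈ F.edgeSet, 0 ≤ w e) {τ : ℝ}
    (h1 : ∀ T : Finset (Sym2 V), (T : Set (Sym2 V)) ⊆ F.edgeSet →
      numComp (remove F T) = numComp F + 1 → τ ≤ weight w T)
    (h2 : (∀ T : Finset (Sym2 V), (T : Set (Sym2 V)) ⊆ F.edgeSet →
      numComp (remove F T) = numComp F + 2 → 2 * τ ≤ weight w T) ∨ ¬ HasCherry (quot F f)) :
    Stable (cellWeight w S f) (quot F f) τ := by
  classical
  have key : ∀ i j z, (quot F f).Adj i j → z ≠ i → (quot F f).Adj j z →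
      2 * τ ≤ wdeg (cellWeight w S f) (quot F f) i + wdeg (cellWeight w S f) (quot F f) j
        - cellWeight w S f i j := by
    intro i j z hij hzi hjz
    rcases h2 with h2 | h2
    -- The second boundary is taken after deleting the first, so edges between the two cells are
    -- paid for once. The third cell `z` guarantees that the second deletion still separates
    -- something.
    · set B := boundary F f i
      set B' := boundary (remove F B) f j
      have hB : numComp F + 1 ≤ numComp (remove F B) := by
        obtain ⟨hne, x, y, hxy, rfl, rfl⟩ := hij
        exact numComp_remove_boundary hxy rfl hne.symm
      have hB' : numComp (remove F B) + 1 ≤ numComp (remove (remove F B) B') := by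
        obtain ⟨hne, x, y, hxy, hx, hy⟩ := hjz
        refine numComp_remove_boundary (x := x) (y := y) ?_ hx (hy.trans_ne hne.symm)
        rw [remove_adj, mem_boundary, hx, hy]
        refine ⟨hxy, ?_⟩
        have := hij.1
        tauto
      rw [remove_remove] at hB'
      obtain ⟨T, hT, hTn⟩ := exists_subset_numComp_eq F (B ∪ B') (n := numComp F + 2)
        (by omega) (by omega)
      have hBB : ((B ∪ B' : Finset _) : Set (Sym2 V)) ⊆ F.edgeSet := by
        rw [Finset.coe_union]
        exact Set.union_subset (boundary_subset i)
          ((boundary_subset j).trans (edgeSet_mono remove_le))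
      have hwT := h2 T ((Finset.coe_subset.2 hT).trans hBB) hTn
      have hw1 := weight_mono (w := w) hT fun e he => hwF e (hBB he)
      have hw2 := weight_union_le (w := w) (T := B) (T' := B')
        fun e he => hwF e (boundary_subset i he)
      have hw3 : weight w B ≤ wdeg (cellWeight w S f) (quot F f) i :=
        weight_boundary_le hS hw (J := fun j => (quot F f).Adj i j)
          fun x y hxy hx hy => ⟨hy.symm, x, y, hxy, hx, rfl⟩
      have hw4 : weight w B' ≤
          ∑ l, if (quot F f).Adj j l ∧ l ≠ i then cellWeight w S f j l else 0 := by
        refine weight_boundary_le (fun x y hxy => hS x y (remove_le hxy)) hw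
          (J := fun l => (quot F f).Adj j l ∧ l ≠ i) fun x y hxy hx hy => ?_
        rw [remove_adj, mem_boundary] at hxy
        refine ⟨⟨hy.symm, x, y, hxy.1, hx, rfl⟩, fun h => hxy.2 ⟨hxy.1, Or.inr ⟨?_, h⟩⟩⟩
        rw [hx]
        exact hij.1.symm
      have hw5 : (∑ l, if (quot F f).Adj j l ∧ l ≠ i then cellWeight w S f j l else 0) +
          cellWeight w S f i j = wdeg (cellWeight w S f) (quot F f) j := by
        have : cellWeight w S f i j = ∑ l, if l = i then cellWeight w S f j l else 0 := by
          simp [cellWeight_comm i j]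
        rw [this, ← Finset.sum_add_distrib]
        refine Finset.sum_congr rfl fun l _ => ?_
        by_cases hl : l = i
        · subst hl
          simp [hij.symm]
        · simp [hl]
      linarith
    · exact absurd ⟨i, j, z, hij, hjz, hzi⟩ h2
  refine ⟨?_, ?_⟩
  · rintro i j ⟨hne, x, y, hxy, rfl, rfl⟩
    obtain ⟨T, hT, hTn⟩ := exists_subset_numComp_eq F (boundary F f (f x)) (n := numComp F + 1)
      (by omega) (numComp_remove_boundary hxy rfl hne.symm)
    have h3 := h1 T ((Finset.coe_subset.2 hT).trans (boundary_subset _)) hTn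
    have h4 := weight_mono (w := w) hT fun e he => hwF e (boundary_subset (f x) he)
    have h5 : weight w (boundary F f (f x)) ≤ wdeg (cellWeight w S f) (quot F f) (f x) :=
      weight_boundary_le hS hw (J := fun j => (quot F f).Adj (f x) j)
        fun x' y' hxy' hx' hy' => ⟨hy'.symm, x', y', hxy', hx', rfl⟩
    linarith
  · rintro i j z hij hzi hzj (h | h)
    · have := key j i z hij.symm hzj h
      rw [cellWeight_comm j i] at this
      linarith
    · exact key i j z hij hzi h

end Quotient

/-! ### The budget invariant -/

section Budget

variable {I : Type*} [Fintype I]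

/-- The amount `x` together with any `m` of the prices `h` is at most the sum of all prices. -/
def Affordable (h : I → ℝ) (x : ℝ) (m : ℕ) : Prop :=
  ∀ A : Finset I, A.card ≤ m → x + ∑ i ∈ A, h i ≤ ∑ i, h i

lemma Affordable.mono {h : I → ℝ} {x y : ℝ} {m n : ℕ} (hx : Affordable h x m) (hn : n ≤ m)
    (hy : y ≤ x) : Affordable h y n := fun A hA => by
  have := hx A (hA.trans hn)
  linarith

lemma Affordable.le {h : I → ℝ} {x : ℝ} {m : ℕ} (hx : Affordable h x m) : x ≤ ∑ i, h i := by
  simpa using hx ∅ (by simp)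

-- Among at least `m` prices that are at least `τ`, a reserve `A` of size `m - t` leaves `t` of them
-- outside. They pay for `t * τ`, and the reserve stays untouched.
open Classical in
lemma Affordable.step {h : I → ℝ} {x τ : ℝ} {m t : ℕ} (hx : Affordable h x m) (ht : t ≤ m)
    (hm : m ≤ (Finset.univ.filter fun i => τ ≤ h i).card) :
    Affordable h (x + t * τ) (m - t) := by
  intro A hA
  have hc : t ≤ ((Finset.univ.filter fun i => τ ≤ h i) \ A).card := by
    have := Finset.le_card_sdiff A (Finset.univ.filter fun i => τ ≤ h i)
    omega
  obtain ⟨B, hB, hBt⟩ := Finset.exists_subset_card_eq hc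
  have hdis : Disjoint A B := by
    rw [Finset.disjoint_left]
    exact fun i hi hi' => (Finset.mem_sdiff.1 (hB hi')).2 hi
  have h1 := hx (A ∪ B) (by rw [Finset.card_union_of_disjoint hdis]; omega)
  rw [Finset.sum_union hdis] at h1
  have h2 : t * τ ≤ ∑ i ∈ B, h i := by
    rw [← hBt, ← nsmul_eq_mul]
    exact Finset.card_nsmul_le_sum _ _ _ fun i hi =>
      (Finset.mem_filter.1 (Finset.mem_sdiff.1 (hB hi)).1).2
  linarith

end Budget

/-! ### Prices obtained from a split, and completion within the budget -/

section Pricing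

variable {V I : Type*} [Fintype V] [Fintype I]

open Classical in
/-- Prices that pay for cheap splits: if splits of `F ≤ G` adding one component weigh at least
`τ`, and those adding two at least `2 * τ` (unless `P F` fails), then enough prices are
at least `τ`. -/
structure Pricing (G : SimpleGraph V) (w : Sym2 V → ℝ) (P : SimpleGraph V → Prop)
    (h : I → ℝ) : Prop where
  mono : ∀ F F', F' ≤ F → P F' → P F
  nonneg : ∀ i, 0 ≤ h i
  count : ∀ F ≤ G, ∀ (τ : ℝ) (T₀ : Finset (Sym2 V)), (T₀ : Set (Sym2 V)) ⊆ F.edgeSet →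
    (τ = weight w T₀ ∨ 2 * τ = weight w T₀) →
    (∀ T : Finset (Sym2 V), (T : Set (Sym2 V)) ⊆ F.edgeSet →
      numComp (remove F T) = numComp F + 1 → τ ≤ weight w T) →
    ((∀ T : Finset (Sym2 V), (T : Set (Sym2 V)) ⊆ F.edgeSet →
      numComp (remove F T) = numComp F + 2 → 2 * τ ≤ weight w T) ∨ ¬ P F) →
    Fintype.card I + (if P F then 1 else 0) ≤
      (Finset.univ.filter fun i => τ ≤ h i).card + numComp F

theorem exists_pricing [LinearOrder I] {G : SimpleGraph V} {w : Sym2 V → ℝ} {S : Finset (Sym2 V)}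
    {f : V → I} (hf : Function.Surjective f) (hSG : (S : Set (Sym2 V)) ⊆ G.edgeSet)
    (hS : ∀ x y, G.Adj x y → f x ≠ f y → s(x, y) ∈ S) (hw : ∀ e ∈ G.edgeSet, 0 ≤ w e)
    {c : ℕ} (hc : 1 ≤ c) (hQ : ∀ s : Finset I, ∀ [DecidableRel (quot G f).Adj],
      ∑ i ∈ s, (s.filter ((quot G f).Adj i)).card ≤ 2 * c * s.card) :
    ∃ (P : SimpleGraph V → Prop) (h : I → ℝ), Pricing G w P h ∧
      ∑ i, h i ≤ (2 - 1 / (70 * c)) * weight w S := by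
  classical
  set E : Finset (Finset (Sym2 V)) := Finset.univ.filter fun T => (T : Set (Sym2 V)) ⊆ G.edgeSet
  -- All weights and half weights of edge sets, hence all densities of 2-way and 3-way splits. A
  -- finite set of thresholds makes the maximum in a price exist.
  set Θ : Finset ℝ := insert 0 (E.image (weight w) ∪ E.image fun T => weight w T / 2)
  have hpos : ∀ T ∈ E, 0 ≤ weight w T := fun T hT =>
    Finset.sum_nonneg fun e he => hw e ((Finset.mem_filter.1 hT).2 he)
  have hΘ : ∀ τ ∈ Θ, 0 ≤ τ := by
    intro τ hτ
    rcases Finset.mem_insert.1 hτ with rfl | hτ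
    · exact le_rfl
    · rcases Finset.mem_union.1 hτ with hτ | hτ
      · obtain ⟨T, hT, rfl⟩ := Finset.mem_image.1 hτ
        exact hpos T hT
      · obtain ⟨T, hT, rfl⟩ := Finset.mem_image.1 hτ
        exact div_nonneg (hpos T hT) zero_le_two
  have h0 : (0 : ℝ) ∈ Θ := Finset.mem_insert_self _ _
  have hwS : ∀ e ∈ S, 0 ≤ w e := fun e he => hw e (hSG he)
  refine ⟨fun F => HasCherry (quot F f), price (cellWeight w S f) (quot G f) Θ,
    ⟨fun F F' hF hP => hP.mono (quot_mono hF f), fun i => maxLevel_nonneg hΘ, ?_⟩, ?_⟩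
  · intro F hFG τ T₀ hT₀ hτ h1 h2
    have hτΘ : τ ∈ Θ := by
      have hT₀E : T₀ ∈ E := Finset.mem_filter.2
        ⟨Finset.mem_univ _, hT₀.trans (edgeSet_mono hFG)⟩
      refine Finset.mem_insert_of_mem (Finset.mem_union.2 ?_)
      rcases hτ with hτ | hτ
      · exact Or.inl (Finset.mem_image.2 ⟨T₀, hT₀E, hτ.symm⟩)
      · exact Or.inr (Finset.mem_image.2 ⟨T₀, hT₀E, by linarith⟩)
    have hst : Stable (cellWeight w S f) (quot F f) τ :=
      stable_quot (fun x y hxy => hS x y (hFG hxy)) hwS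
        (fun e he => hw e (edgeSet_mono hFG he)) h1 h2
    refine (card_le_card_counted_add (quot F f)).trans
      (add_le_add (Finset.card_le_card fun v hv => ?_) (numComp_quot_le F hf))
    exact Finset.mem_filter.2 ⟨Finset.mem_univ _,
      le_price (quot_mono hFG f) hst hτΘ (Finset.mem_filter.1 hv).2⟩
  · refine (sum_price_le (cellWeight_nonneg hwS) cellWeight_comm hΘ h0 hc fun s => hQ s).trans ?_
    have hc' : (1 : ℝ) ≤ c := by exact_mod_cast hc
    have : 1 / (140 * (c : ℝ)) ≤ 1 := by
      rw [div_le_one (by positivity)]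
      linarith
    refine (mul_le_mul_of_nonneg_left (sum_cellWeight_le (f := f) hwS) (by linarith)).trans_eq ?_
    field_simp
    ring

variable {G : SimpleGraph V} {w : Sym2 V → ℝ}

lemma exists_min_weight (w : Sym2 V → ℝ) {p : Finset (Sym2 V) → Prop} (h : ∃ T, p T) :
    ∃ T, p T ∧ ∀ T', p T' → weight w T ≤ weight w T' := by
  classical
  obtain ⟨T, hT⟩ := h
  obtain ⟨T, hT, hmin⟩ := Finset.exists_min_image (Finset.univ.filter p) (weight w)
    ⟨T, by simpa using hT⟩
  exact ⟨T, by simpa using hT, fun T' hT' => hmin T' (by simpa using hT')⟩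

variable [DecidableEq V]

lemma exists_numComp_eq (F : SimpleGraph V) {n : ℕ} (h1 : numComp F ≤ n)
    (h2 : n ≤ Fintype.card V) :
    ∃ T : Finset (Sym2 V), (T : Set (Sym2 V)) ⊆ F.edgeSet ∧ numComp (remove F T) = n := by
  classical
  obtain ⟨T, hT, h⟩ := exists_subset_numComp_eq F F.edgeFinset h1 (by
    have : remove F F.edgeFinset = ⊥ := by
      ext x y
      simp [remove_adj]
    rw [this, numComp_bot, Nat.card_eq_fintype_card]
    exact h2)
  exact ⟨T, fun e he => by simpa using hT he, h⟩

open Classical in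
/-- Within the budget, a subgraph can be split into exactly `k` components. -/
lemma exists_affordable_split {P : SimpleGraph V → Prop} {h : I → ℝ} (hP : Pricing G w P h)
    (hw : ∀ e ∈ G.edgeSet, 0 ≤ w e) (hk : Fintype.card I ≤ Fintype.card V) (n : ℕ) :
    ∀ (F : SimpleGraph V) (x : ℝ), F ≤ G → numComp F + n = Fintype.card I →
      Affordable h x (n + if P F then 1 else 0) →
      ∃ T : Finset (Sym2 V), (T : Set (Sym2 V)) ⊆ F.edgeSet ∧
        numComp (remove F T) = Fintype.card I ∧ x + weight w T ≤ ∑ i, h i := by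
  induction n using Nat.strong_induction_on with
  | _ n ih =>
  intro F x hFG hn hx
  have hwF : ∀ T : Finset (Sym2 V), (T : Set (Sym2 V)) ⊆ F.edgeSet → ∀ e ∈ T, 0 ≤ w e :=
    fun T hT e he => hw e (edgeSet_mono hFG (hT he))
  rcases Nat.eq_zero_or_pos n with rfl | hnpos
  · exact ⟨∅, by simp, by rw [remove_empty]; omega, by simpa [weight] using hx.le⟩
  -- A split adding `t` components at cost at most `t * τ` uses up `t` prices; the rest follows by
  -- induction. The extra unit can only disappear, since `P` is monotone.
  have cont : ∀ (t : ℕ) (T : Finset (Sym2 V)) (τ : ℝ), 1 ≤ t → t ≤ n →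
      (T : Set (Sym2 V)) ⊆ F.edgeSet → numComp (remove F T) = numComp F + t →
      weight w T ≤ t * τ →
      n + (if P F then 1 else 0) ≤ (Finset.univ.filter fun i => τ ≤ h i).card →
      ∃ T : Finset (Sym2 V), (T : Set (Sym2 V)) ⊆ F.edgeSet ∧
        numComp (remove F T) = Fintype.card I ∧ x + weight w T ≤ ∑ i, h i := by
    intro t T τ ht htn hT hTn hTw hcard
    have hle : (if P (remove F T) then 1 else 0) ≤ if P F then 1 else 0 := by
      by_cases hPT : P (remove F T)
      · simp [hPT, hP.mono _ _ remove_le hPT]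
      · simp [hPT]
    obtain ⟨T', hT', hn', hw'⟩ := ih (n - t) (by omega) (remove F T) (x + weight w T)
      (remove_le.trans hFG) (by omega)
      ((hx.step (t := t) (by omega) hcard).mono (by omega) (by linarith))
    refine ⟨T ∪ T', ?_, by rw [← remove_remove]; exact hn', ?_⟩
    · rw [Finset.coe_union]
      exact Set.union_subset hT (hT'.trans (edgeSet_mono remove_le))
    · have := weight_union_le (w := w) (T' := T') (hwF T hT)
      linarith
  obtain ⟨T, ⟨hT, hTn⟩, hTmin⟩ := exists_min_weight w
    (exists_numComp_eq F (n := numComp F + 1) (by omega) (by omega))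
  by_cases hcase : ¬ P F ∨ ∀ T' : Finset (Sym2 V), (T' : Set (Sym2 V)) ⊆ F.edgeSet →
      numComp (remove F T') = numComp F + 2 → 2 * weight w T ≤ weight w T'
  · have := hP.count F hFG (weight w T) T hT (Or.inl rfl) (fun T' h1 h2 => hTmin T' ⟨h1, h2⟩)
      hcase.symm
    exact cont 1 T (weight w T) le_rfl hnpos hT hTn (by simp) (by omega)
  · push Not at hcase
    obtain ⟨hPF, T₁, hT₁, hT₁n, hT₁w⟩ := hcase
    obtain ⟨T₂, ⟨hT₂, hT₂n⟩, hT₂min⟩ := exists_min_weight w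
      (p := fun T => (T : Set (Sym2 V)) ⊆ F.edgeSet ∧ numComp (remove F T) = numComp F + 2)
      ⟨T₁, hT₁, hT₁n⟩
    have hlt := hT₂min T₁ ⟨hT₁, hT₁n⟩
    -- Here the cheapest 3-way split has smaller density than the cheapest 2-way split, so half its
    -- weight is a valid threshold for both conditions.
    have hcnt := hP.count F hFG (weight w T₂ / 2) T₂ hT₂ (Or.inr (by ring))
      (fun T' h1 h2 => by linarith [hTmin T' ⟨h1, h2⟩])
      (Or.inl fun T' h1 h2 => by linarith [hT₂min T' ⟨h1, h2⟩])
    by_cases hn2 : 2 ≤ n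
    · exact cont 2 T₂ (weight w T₂ / 2) (by norm_num) hn2 hT₂ hT₂n
        (by push_cast; linarith) (by omega)
    -- Only one component is missing, so part of the 3-way split suffices. Its full weight is
    -- charged to two prices, and the second one exists because `P F` holds.
    · obtain ⟨T₃, hT₃, hT₃n⟩ := exists_subset_numComp_eq F T₂ (n := numComp F + 1)
        (by omega) (by omega)
      refine ⟨T₃, (Finset.coe_subset.2 hT₃).trans hT₂, by omega, ?_⟩
      have h1 := weight_mono (w := w) hT₃ (hwF T₂ hT₂)
      have h2 := (hx.step (t := 2) (τ := weight w T₂ / 2)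
        (by simp only [hPF, if_true]; omega) (by omega)).le
      push_cast at h2
      linarith

end Pricing

/-! ### The greedy algorithm stays within the budget -/

section Greedy

variable {V : Type*} {G : SimpleGraph V} {w : Sym2 V → ℝ} {k : ℕ}

lemma sepDegree_eq [Finite V] (hG : G.Connected) (C : Finset (Sym2 V)) :
    sepDegree G C = numComp (remove G C) := by
  have h1 := numComp_mono (remove_le (G := G) (S := C))
  have h2 := numComp_eq_one hG
  rw [sepDegree]
  omega

lemma density_eq {F : SimpleGraph V} {T : Finset (Sym2 V)} {t : ℕ}
    (h : numComp (remove F T) = numComp F + t) : density F w T = weight w T / t := by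
  have : sepDegree F T = t + 1 := by
    rw [sepDegree]
    omega
  rw [density, this]
  simp

lemma isSplitUpTo_three {F : SimpleGraph V} {T : Finset (Sym2 V)} :
    IsSplitUpTo F 3 T ↔ (T : Set (Sym2 V)) ⊆ F.edgeSet ∧
      ∃ t, (t = 1 ∨ t = 2) ∧ numComp (remove F T) = numComp F + t := by
  constructor
  · rintro ⟨j, h2, h3, hT, _, h⟩
    exact ⟨hT, j - 1, by omega, by omega⟩
  · rintro ⟨hT, t, ht, h⟩
    exact ⟨t + 1, by omega, by omega, hT, by omega, by omega⟩

variable [Fintype V] [DecidableEq V]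

/-- Each iteration adds one or two components. The loop runs only up to degree `k - 4`, so it never
overshoots `k`. -/
lemma PhaseOne.bounds (hG : G.Connected) (hk : 1 ≤ k) {i : ℕ} {C : Finset (Sym2 V)}
    (h : PhaseOne G w k i C) : (C : Set (Sym2 V)) ⊆ G.edgeSet ∧
      i + 1 ≤ numComp (remove G C) ∧ numComp (remove G C) ≤ k := by
  induction h with
  | start => simp [remove_empty, numComp_eq_one hG, hk]
  | step _ hd hC' ih =>
    obtain ⟨hT, t, ht, hn⟩ := isSplitUpTo_three.1 hC'.1
    rw [sepDegree_eq hG] at hd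
    refine ⟨?_, ?_, ?_⟩
    · rw [Finset.coe_union]
      exact Set.union_subset ih.1 (hT.trans (edgeSet_mono remove_le))
    all_goals
      rw [← remove_remove]
      omega

open Classical in
lemma PhaseOne.affordable (hG : G.Connected) (hw : ∀ e ∈ G.edgeSet, 0 ≤ w e) (hk : 1 ≤ k)
    {P : SimpleGraph V → Prop} {h : Fin k → ℝ} (hP : Pricing G w P h)
    {i : ℕ} {C : Finset (Sym2 V)} (hC : PhaseOne G w k i C) :
    Affordable h (weight w C)
      (k - numComp (remove G C) + if P (remove G C) then 1 else 0) := by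
  induction hC with
  | start =>
    intro A _
    simpa [weight] using Finset.sum_le_sum_of_subset_of_nonneg (Finset.subset_univ A)
      fun i _ _ => hP.nonneg i
  | @step i C C' hC hd hC' ih =>
    obtain ⟨hCG, -, -⟩ := hC.bounds hG hk
    obtain ⟨hT, t, ht, hn⟩ := isSplitUpTo_three.1 hC'.1
    rw [sepDegree_eq hG] at hd
    have htpos : (0 : ℝ) < t := by
      have : 0 < t := by omega
      exact_mod_cast this
    have hdens := hC'.2
    rw [density_eq hn] at hdens
    -- Minimum density gives both conditions at once: 2-way splits weigh at least the density, 3-way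
    -- splits at least twice it.
    have hcnt := hP.count (remove G C) remove_le (weight w C' / t) C' hT
      (by rcases ht with rfl | rfl
          · left; simp
          · right; push_cast; ring)
      (fun T h1 h2 => by
        have := hdens T (isSplitUpTo_three.2 ⟨h1, 1, Or.inl rfl, h2⟩)
        rw [density_eq h2] at this
        simpa using this)
      (Or.inl fun T h1 h2 => by
        have := hdens T (isSplitUpTo_three.2 ⟨h1, 2, Or.inr rfl, h2⟩)
        rw [density_eq h2] at this
        push_cast at this
        linarith)
    rw [Fintype.card_fin] at hcnt
    have hle : (if P (remove G (C ∪ C')) then 1 else 0) ≤ if P (remove G C) then 1 else 0 := by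
      by_cases hPT : P (remove G (C ∪ C'))
      · simp [hPT, hP.mono _ _ (remove_anti Finset.subset_union_left) hPT]
      · simp [hPT]
    refine (ih.step (t := t) (τ := weight w C' / t) (by omega) (by omega)).mono ?_ ?_
    · rw [← remove_remove, hn] at *
      omega
    · rw [mul_div_cancel₀ _ htpos.ne']
      exact weight_union_le fun e he => hw e (hCG he)

/-- The pricing may depend on the split `S` compared with. Phase two takes a minimum split, so it is
no heavier than the affordable completion of the phase one set. -/
theorem greedyApproximates_of_pricing (hG : G.Connected) (hw : ∀ e ∈ G.edgeSet, 0 ≤ w e)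
    (hk : 1 ≤ k) (hkV : k ≤ Fintype.card V) {ρ : ℝ}
    (hρ : ∀ S, IsSplit G k S → ∃ (P : SimpleGraph V → Prop) (h : Fin k → ℝ),
      Pricing G w P h ∧ ∑ i, h i ≤ ρ * weight w S) : GreedyApproximates ρ G w k := by
  classical
  have hfin : ∀ i C, PhaseOne G w k i C →
      ∃ C', IsMinSplit (remove G C) w (k - sepDegree G C + 1) C' := by
    intro i C hC
    obtain ⟨-, -, hle⟩ := hC.bounds hG hk
    obtain ⟨T, hT, hTn⟩ := exists_numComp_eq (remove G C) hle hkV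
    rw [sepDegree_eq hG]
    exact exists_min_weight w ⟨T, hT, by omega, by omega⟩
  have hstep : ∀ i C, PhaseOne G w k i C → sepDegree G C + 4 ≤ k →
      ∃ C', IsMinDensitySplit (remove G C) w 3 C' := by
    intro i C hC hd
    rw [sepDegree_eq hG] at hd
    obtain ⟨T, hT, hTn⟩ := exists_numComp_eq (remove G C)
      (n := numComp (remove G C) + 1) (by omega) (by omega)
    obtain ⟨C', hC', hmin⟩ := Finset.exists_min_image
      (Finset.univ.filter (IsSplitUpTo (remove G C) 3)) (density (remove G C) w)
      ⟨T, by
        rw [Finset.mem_filter, isSplitUpTo_three]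
        exact ⟨Finset.mem_univ _, hT, 1, Or.inl rfl, hTn⟩⟩
    exact ⟨C', (Finset.mem_filter.1 hC').2, fun S hS =>
      hmin S (Finset.mem_filter.2 ⟨Finset.mem_univ _, hS⟩)⟩
  refine ⟨fun i C hC => ?_, ?_, ?_⟩
  · obtain ⟨-, h1, h2⟩ := hC.bounds hG hk
    exact ⟨by omega, hstep i C hC, fun _ => ⟨by rwa [sepDegree_eq hG], hfin i C hC⟩⟩
  -- Induction on the number of components still missing, which drops in every iteration.
  · have hrun : ∀ n i C, PhaseOne G w k i C → k ≤ sepDegree G C + n →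
        ∃ D, IsGreedyOutput G w k D := by
      intro n
      induction n with
      | zero =>
        intro i C hC hn
        obtain ⟨C', hC'⟩ := hfin i C hC
        exact ⟨_, i, C, C', hC, by omega, hC', rfl⟩
      | succ n ih =>
        intro i C hC hn
        by_cases hd : sepDegree G C + 4 ≤ k
        · obtain ⟨C', hC'⟩ := hstep i C hC hd
          refine ih (i + 1) (C ∪ C') (.step hC hd hC') ?_
          obtain ⟨-, t, ht, hn'⟩ := isSplitUpTo_three.1 hC'.1
          rw [sepDegree_eq hG] at hn ⊢
          rw [← remove_remove]
          omega
        · obtain ⟨C', hC'⟩ := hfin i C hC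
          exact ⟨_, i, C, C', hC, by omega, hC', rfl⟩
    exact hrun k 0 ∅ .start (by omega)
  · rintro D ⟨i, C, C', hC, -, ⟨hC', hmin⟩, rfl⟩
    obtain ⟨hCG, -, hle⟩ := hC.bounds hG hk
    rw [sepDegree_eq hG] at hC' hmin
    obtain ⟨hC'F, -, hn⟩ := hC'
    refine ⟨⟨?_, hk, ?_⟩, fun S hS => ?_⟩
    · rw [Finset.coe_union]
      exact Set.union_subset hCG (hC'F.trans (edgeSet_mono remove_le))
    · rw [← remove_remove, numComp_eq_one hG]
      omega
    · obtain ⟨P, h, hP, hsum⟩ := hρ S hS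
      obtain ⟨T, hT, hTn, hTw⟩ := exists_affordable_split hP hw (by simpa using hkV)
        (k - numComp (remove G C)) (remove G C) (weight w C) remove_le
        (by rw [Fintype.card_fin]; omega) (hC.affordable hG hw hk hP)
      rw [Fintype.card_fin] at hTn
      have h1 := hmin T ⟨hT, by omega, by omega⟩
      have h2 := weight_union_le (w := w) (T := C) (T' := C') fun e he => hw e (hCG he)
      linarith

end Greedy

/-! ### Operations on minors -/

section Minors

variable {α β V : Type*}

lemma IsMinor.trans {A : SimpleGraph α} {B : SimpleGraph β} {G : SimpleGraph V}
    (h₁ : IsMinor A B) (h₂ : IsMinor B G) : IsMinor A G := by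
  obtain ⟨S, hS, hSd, hSa⟩ := h₁
  obtain ⟨R, hR, hRd, hRa⟩ := h₂
  have hsub : ∀ x, ∀ b ∈ S x, R b ⊆ ⋃ b ∈ S x, R b := fun x b hb =>
    Set.subset_biUnion_of_mem hb
  refine ⟨fun x => ⋃ b ∈ S x, R b, fun x => ?_, fun x y hxy => ?_, fun x y hxy => ?_⟩
  · set U := ⋃ b ∈ S x, R b
    have hin : ∀ b (hb : b ∈ S x) u v (hu : u ∈ R b) (hv : v ∈ R b),
        (G.induce U).Reachable ⟨u, hsub x b hb hu⟩ ⟨v, hsub x b hb hv⟩ := fun b hb u v hu hv =>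
      ((hR b).preconnected ⟨u, hu⟩ ⟨v, hv⟩).map (induceHomOfLE G (hsub x b hb)).toHom
    have hwalk : ∀ b b' : S x, (B.induce (S x)).Reachable b b' →
        ∀ u v (hu : u ∈ R b) (hv : v ∈ R b'),
        (G.induce U).Reachable ⟨u, hsub x b b.2 hu⟩ ⟨v, hsub x b' b'.2 hv⟩ := by
      rintro b b' ⟨p⟩
      induction p with
      | nil => exact fun u v hu hv => hin _ (Subtype.coe_prop _) u v hu hv
      | @cons b c d hbc p ih =>
        intro u v hu hv
        obtain ⟨u', hu', v', hv', huv⟩ := hRa b c hbc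
        exact ((hin b b.2 u u' hu hu').trans
          (Adj.reachable (show (G.induce U).Adj ⟨u', hsub x b b.2 hu'⟩ ⟨v', hsub x c c.2 hv'⟩
            from huv))).trans (ih v' v hv' hv)
    refine (connected_iff _).2 ⟨?_, ?_⟩
    · rintro ⟨u, hu⟩ ⟨v, hv⟩
      obtain ⟨b, hb, hub⟩ := Set.mem_iUnion₂.1 hu
      obtain ⟨c, hc, hvc⟩ := Set.mem_iUnion₂.1 hv
      exact hwalk ⟨b, hb⟩ ⟨c, hc⟩ ((hS x).preconnected _ _) u v hub hvc
    · obtain ⟨b, hb⟩ := (hS x).nonempty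
      obtain ⟨u, hu⟩ := (hR b).nonempty
      exact ⟨⟨u, hsub x b hb hu⟩⟩
  · simp only [Set.disjoint_iUnion_left, Set.disjoint_iUnion_right]
    exact fun c hc b hb => hRd b c fun h => Set.disjoint_left.1 (hSd x y hxy) hb (h ▸ hc)
  · obtain ⟨b, hb, c, hc, hbc⟩ := hSa x y hxy
    obtain ⟨u, hu, v, hv, huv⟩ := hRa b c hbc
    exact ⟨u, hsub x b hb hu, v, hsub y c hc hv, huv⟩

lemma isMinor_quot {G : SimpleGraph V} {f : V → α}
    (hf : ∀ i, (G.induce (f ⁻¹' {i})).Connected) : IsMinor (quot G f) G := by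
  refine ⟨fun i => f ⁻¹' {i}, hf, fun i j hij => ?_, ?_⟩
  · rw [Set.disjoint_left]
    rintro x rfl h
    exact hij h
  · rintro i j ⟨-, x, y, hxy, hx, hy⟩
    exact ⟨x, hx, y, hy, hxy⟩

lemma connected_induce_image {G : SimpleGraph V} {s : Set V} {B : Set s}
    (h : ((G.induce s).induce B).Connected) : (G.induce (Subtype.val '' B)).Connected := by
  let φ : (G.induce s).induce B →g G.induce (Subtype.val '' B) :=
    ⟨fun z => ⟨z.1.1, z.1, z.2, rfl⟩, fun h => h⟩
  refine h.map φ ?_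
  rintro ⟨_, z, hz, rfl⟩
  exact ⟨⟨z, hz⟩, rfl⟩

lemma connected_induce_singleton (G : SimpleGraph V) (x : V) : (G.induce {x}).Connected :=
  Connected.of_subsingleton

lemma isMinor_induce (G : SimpleGraph V) (s : Set V) : IsMinor (G.induce s) G := by
  refine ⟨fun x => {x.1}, fun x => Connected.of_subsingleton, fun x y hxy => ?_, fun x y hxy => ?_⟩
  · simpa [Subtype.ext_iff] using hxy
  · exact ⟨x, rfl, y, rfl, hxy⟩

lemma IsMinor.of_top {m : ℕ} [Fintype α] (H : SimpleGraph α) {G : SimpleGraph V}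
    (h : IsMinor (⊤ : SimpleGraph (Fin m)) G) (hm : Fintype.card α ≤ m) : IsMinor H G := by
  obtain ⟨B, h1, h2, h3⟩ := h
  obtain ⟨e⟩ := Function.Embedding.nonempty_of_card_le (α := α) (β := Fin m) (by simpa using hm)
  exact ⟨fun x => B (e x), fun x => h1 _, fun x y hxy => h2 _ _ (e.injective.ne hxy),
    fun x y hxy => h3 _ _ (e.injective.ne hxy.ne)⟩

lemma isMinor_cone {G : SimpleGraph V} {x : V} {n : ℕ}
    (h : IsMinor (⊤ : SimpleGraph (Fin n)) (G.induce (G.neighborSet x))) :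
    IsMinor (⊤ : SimpleGraph (Fin (n + 1))) G := by
  obtain ⟨B, h1, h2, h3⟩ := h
  have hx : ∀ i, Disjoint {x} (Subtype.val '' B i) := by
    intro i
    rw [Set.disjoint_singleton_left]
    rintro ⟨z, -, hz⟩
    have := z.2
    rw [hz] at this
    exact G.loopless.irrefl x this
  refine ⟨Fin.cases {x} fun i => Subtype.val '' B i, fun i => ?_, fun i j => ?_, fun i j => ?_⟩
  · refine Fin.cases ?_ (fun i => ?_) i
    · exact connected_induce_singleton G x
    · exact connected_induce_image (h1 i)
  · refine Fin.cases ?_ (fun i => ?_) i <;> refine Fin.cases ?_ (fun j => ?_) j <;> intro hij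
    · exact absurd rfl hij
    · exact hx j
    · exact (hx i).symm
    · exact (Set.disjoint_image_iff Subtype.val_injective).2
        (h2 i j fun h => hij (congrArg _ h))
  · refine Fin.cases ?_ (fun i => ?_) i <;> refine Fin.cases ?_ (fun j => ?_) j <;> intro hij
    · exact absurd rfl hij.ne
    · obtain ⟨z⟩ := (h1 j).nonempty
      exact ⟨x, rfl, z.1, ⟨z.1, z.2, rfl⟩, z.1.2⟩
    · obtain ⟨z⟩ := (h1 i).nonempty
      exact ⟨z.1, ⟨z.1, z.2, rfl⟩, x, rfl, z.1.2.symm⟩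
    · obtain ⟨a, ha, b, hb, hab⟩ := h3 i j fun h => hij.ne (congrArg _ h)
      exact ⟨a, ⟨a, ha, rfl⟩, b, ⟨b, hb, rfl⟩, hab⟩

end Minors

/-! ### Dense graphs have large complete minors -/

section Density

universe u

open Classical in
/-- The sum of the degrees. -/
noncomputable def degSum {V : Type*} [Fintype V] (G : SimpleGraph V) : ℕ :=
  ∑ i, (Finset.univ.filter (G.Adj i)).card

open Classical in
/-- The number of common neighbours. -/
noncomputable def codegree {V : Type*} [Fintype V] (G : SimpleGraph V) (x y : V) : ℕ :=
  (Finset.univ.filter fun z => G.Adj x z ∧ G.Adj y z).card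

open Classical in
lemma degSum_eq_card {V : Type*} [Fintype V] (G : SimpleGraph V) :
    degSum G = (Finset.univ.filter fun p : V × V => G.Adj p.1 p.2).card := by
  simp only [degSum, Finset.card_filter, ← Finset.univ_product_univ, Finset.sum_product]

open Classical in
lemma degSum_induce {V : Type*} [Fintype V] (G : SimpleGraph V) (s : Finset V) :
    degSum (G.induce (s : Set V)) = ∑ i ∈ s, (s.filter (G.Adj i)).card := by
  simp only [degSum, Finset.card_filter]
  rw [← Finset.sum_coe_sort s]
  refine Finset.sum_congr rfl fun i _ => ?_
  rw [← Finset.sum_coe_sort s]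
  rfl

/-- Contract `y` into `x`. -/
noncomputable def contractMap {V : Type*} {x y : V} (hxy : x ≠ y) (v : V) : {v : V // v ≠ y} :=
  open Classical in if h : v = y then ⟨x, hxy⟩ else ⟨v, h⟩

lemma contractMap_eq_iff {V : Type*} {x y : V} (hxy : x ≠ y) {u v : V} :
    contractMap hxy u = contractMap hxy v ↔ u = v ∨ (u = x ∧ v = y) ∨ (u = y ∧ v = x) := by
  unfold contractMap
  by_cases hu : u = y <;> by_cases hv : v = y
  · simp [hu, hv]
  · subst hu
    simp only [dif_pos, hv, dif_neg, not_false_eq_true, Subtype.mk.injEq]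
    tauto
  · subst hv
    simp only [dif_pos, hu, dif_neg, not_false_eq_true, Subtype.mk.injEq]
    tauto
  · simp [hu, hv]

lemma connected_contractMap {V : Type*} {G : SimpleGraph V} {x y : V} (h : G.Adj x y)
    (i : {v : V // v ≠ y}) : (G.induce (contractMap h.ne ⁻¹' {i})).Connected := by
  have hi : contractMap h.ne i.1 = i := by simp [contractMap, i.2]
  refine (connected_iff_exists_forall_reachable _).2 ⟨⟨i.1, hi⟩, ?_⟩
  rintro ⟨v, hv⟩
  have hv' : contractMap h.ne i.1 = contractMap h.ne v := hi.trans hv.symm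
  rcases (contractMap_eq_iff h.ne).1 hv' with rfl | ⟨h1, rfl⟩ | ⟨h1, -⟩
  · exact Reachable.refl _
  · refine Adj.reachable ?_
    simp only [comap_adj, Function.Embedding.subtype_apply, h1]
    exact h
  · exact absurd h1 i.2

/-- Away from `xy` itself and the edges from `y` to common neighbours, contraction neither kills nor
identifies adjacent pairs. The lost pairs are counted in both orders. -/
lemma degSum_le_contract {V : Type*} [Fintype V] {G : SimpleGraph V} {x y : V} (h : G.Adj x y)
    [Fintype {v : V // v ≠ y}] :
    degSum G ≤ degSum (quot G (contractMap h.ne)) + 2 * codegree G x y + 2 := by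
  classical
  rw [degSum_eq_card, degSum_eq_card]
  set N := Finset.univ.filter fun z => G.Adj x z ∧ G.Adj y z
  set A := Finset.univ.filter fun p : V × V => G.Adj p.1 p.2
  set D : Finset (V × V) := {(x, y), (y, x)} ∪ N.image (fun z => (y, z)) ∪ N.image fun z => (z, y)
  have hD : D.card ≤ 2 * codegree G x y + 2 := by
    have h1 : D.card ≤ _ := Finset.card_union_le ({(x, y), (y, x)} ∪ N.image (fun z => (y, z)))
      (N.image fun z => (z, y))
    have h2 := Finset.card_union_le ({(x, y), (y, x)} : Finset (V × V))
      (N.image (fun z => (y, z)))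
    have h3 : (N.image fun z => (z, y)).card ≤ codegree G x y := Finset.card_image_le
    have h4 : (N.image fun z => (y, z)).card ≤ codegree G x y := Finset.card_image_le
    have h5 : ({(x, y), (y, x)} : Finset (V × V)).card ≤ 2 := Finset.card_le_two
    omega
  have hAD : (A \ D).card ≤ (Finset.univ.filter fun p : {v : V // v ≠ y} × {v : V // v ≠ y} =>
      (quot G (contractMap h.ne)).Adj p.1 p.2).card := by
    refine Finset.card_le_card_of_injOn
      (fun p => (contractMap h.ne p.1, contractMap h.ne p.2)) ?_ ?_
    · rintro ⟨u, v⟩ hp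
      simp only [Finset.coe_sdiff, Set.mem_sdiff, Finset.mem_coe, A, D, Finset.mem_filter,
        Finset.mem_univ, true_and, Finset.mem_union, Finset.mem_insert, Finset.mem_singleton,
        Prod.mk.injEq, not_or] at hp
      refine Finset.mem_coe.2 (Finset.mem_filter.2 ⟨Finset.mem_univ _, fun heq => ?_, u, v, hp.1,
        rfl, rfl⟩)
      have := hp.1.ne
      rcases (contractMap_eq_iff h.ne).1 heq with h' | h' | h' <;> tauto
    · rintro ⟨u, v⟩ hp ⟨u', v'⟩ hp' heq
      simp only [Finset.coe_sdiff, Set.mem_sdiff, Finset.mem_coe, A, D, N, Finset.mem_filter,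
        Finset.mem_univ, true_and, Finset.mem_union, Finset.mem_insert, Finset.mem_singleton,
        Finset.mem_image, Prod.mk.injEq, not_or, not_exists, not_and] at hp hp'
      simp only [Prod.mk.injEq, contractMap_eq_iff] at heq ⊢
      obtain ⟨hadj, ⟨⟨h1, h2⟩, h3⟩, h4⟩ := hp
      obtain ⟨hadj', ⟨⟨h1', h2'⟩, h3'⟩, h4'⟩ := hp'
      have hne := hadj.ne
      have hne' := hadj'.ne
      have e1 := hadj.symm
      have e2 := hadj'.symm
      have e3 := h.symm
      obtain ⟨q1, q2⟩ := heq
      rcases q1 with rfl | ⟨rfl, rfl⟩ | ⟨rfl, rfl⟩ <;>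
        rcases q2 with rfl | ⟨rfl, rfl⟩ | ⟨rfl, rfl⟩ <;> grind
  have := Finset.card_le_card_sdiff_add_card (s := A) (t := D)
  omega

/-- A graph of average degree at least `2 ^ t` contains the complete graph on `t + 2` vertices
as a minor. -/
theorem isMinor_top_of_le_degSum (t : ℕ) : ∀ {V : Type u} [Fintype V] [Nonempty V]
    (G : SimpleGraph V), 2 ^ t * Fintype.card V ≤ degSum G →
    IsMinor (⊤ : SimpleGraph (Fin (t + 2))) G := by
  classical
  have hedge : ∀ (t : ℕ) {V : Type u} [Fintype V] [Nonempty V] (G : SimpleGraph V),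
      2 ^ t * Fintype.card V ≤ degSum G → ∃ x y, G.Adj x y := by
    intro t V _ _ G h
    by_contra hno
    push Not at hno
    have h0 : degSum G = 0 := by simp [degSum, hno]
    have : 0 < 2 ^ t * Fintype.card V := Nat.mul_pos (by positivity) Fintype.card_pos
    omega
  induction t with
  | zero =>
    intro V _ _ G h
    obtain ⟨x, y, hxy⟩ := hedge 0 G h
    refine ⟨![{x}, {y}], fun i => ?_, fun i j hij => ?_, fun i j hij => ?_⟩
    · fin_cases i
      exacts [connected_induce_singleton G x, connected_induce_singleton G y]
    · have := hxy.ne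
      have := hxy.ne'
      fin_cases i <;> fin_cases j <;> simp_all
    · have := hij.ne
      have := hxy.symm
      fin_cases i <;> fin_cases j <;> simp_all
  | succ t iht =>
    have main : ∀ (n : ℕ) {V : Type u} [Fintype V] [Nonempty V] (G : SimpleGraph V),
        Fintype.card V = n → 2 ^ (t + 1) * Fintype.card V ≤ degSum G →
        IsMinor (⊤ : SimpleGraph (Fin (t + 1 + 2))) G := by
      intro n
      induction n with
      | zero =>
        intro V _ _ G hn
        exact absurd hn Fintype.card_ne_zero
      | succ n ihn =>
        intro V _ _ G hn h
        obtain ⟨x, y₀, hxy₀⟩ := hedge (t + 1) G h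
        -- An edge with few common neighbours can be contracted without lowering the average degree
        -- below the bound. If `x` has no such edge, its neighbourhood induces a graph of minimum
        -- degree at least `2 ^ t`. Induction on `t` applies there, and `x` is the additional branch
        -- set.
        by_cases hex : ∃ y, G.Adj x y ∧ 2 * codegree G x y + 2 ≤ 2 ^ (t + 1)
        · obtain ⟨y, hxy, hcod⟩ := hex
          have hcard : Fintype.card {v : V // v ≠ y} = n := by
            rw [Fintype.card_subtype_compl, Fintype.card_subtype_eq]
            omega
          have : Nonempty {v : V // v ≠ y} := ⟨⟨x, hxy.ne⟩⟩
          refine (ihn (quot G (contractMap hxy.ne)) hcard ?_).trans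
            (isMinor_quot (connected_contractMap hxy))
          have := degSum_le_contract hxy
          rw [hcard]
          rw [hn, mul_add] at h
          omega
        · push Not at hex
          have hmem : G.neighborSet x =
              ((Finset.univ.filter (G.Adj x) : Finset V) : Set V) := by
            ext; simp
          refine isMinor_cone (x := x) (n := t + 2) ?_
          rw [hmem]
          have : Nonempty ((Finset.univ.filter (G.Adj x) : Finset V) : Set V) :=
            ⟨⟨y₀, by simpa using hxy₀⟩⟩
          refine iht _ ?_
          rw [degSum_induce]
          simp only [Finset.coe_sort_coe, Fintype.card_coe]
          rw [mul_comm, ← smul_eq_mul]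
          refine Finset.card_nsmul_le_sum _ _ _ fun y hy => ?_
          have h1 := hex y (by simpa using hy)
          rw [pow_succ] at h1
          have h2 : ((Finset.univ.filter (G.Adj x)).filter (G.Adj y)).card = codegree G x y := by
            rw [Finset.filter_filter, codegree]
          omega
    exact fun {V} _ _ G h => main _ G rfl h

end Density

/-! ### A parity obstruction to drawing the complete graph on five vertices -/

section Winding

lemma exists_continuous_log {A : Type*} [TopologicalSpace A] [SimplyConnectedSpace A]
    [LocallyPathConnectedSpace A] (g : C(A, ℂ)) (hg : ∀ a, g a ≠ 0) :
    ∃ L : C(A, ℂ), ∀ a, Complex.exp (L a) = g a := by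
  obtain ⟨a₀⟩ : Nonempty A := inferInstance
  obtain ⟨L, ⟨-, hL⟩, -⟩ := Complex.isCoveringMapOn_exp.existsUnique_continuousMap_lifts g
    (a₀ := a₀) (Complex.exp_log (hg a₀)) hg
  exact ⟨L, fun a => congrFun hL a⟩

/-- Shifted to the same starting value, two continuous logarithms of one function are lifts through
the same covering, hence equal. -/
lemma log_increment_unique {L L' : C(ℝ, ℂ)} (h : ∀ s, Complex.exp (L s) = Complex.exp (L' s)) :
    L 1 - L 0 = L' 1 - L' 0 := by
  obtain ⟨F, -, hF⟩ := Complex.isCoveringMapOn_exp.existsUnique_continuousMap_lifts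
    (⟨fun s => Complex.exp (L s), by fun_prop⟩ : C(ℝ, ℂ)) (a₀ := 0) (e₀ := L 0) rfl
    fun s => Complex.exp_ne_zero _
  have h1 := hF L ⟨rfl, rfl⟩
  have h2 := hF (L' + ContinuousMap.const ℝ (L 0 - L' 0)) ⟨by simp, by
    funext s
    simp only [Function.comp_apply, ContinuousMap.add_apply, ContinuousMap.const_apply,
      ContinuousMap.coe_mk, Complex.exp_add, Complex.exp_sub, h]
    field_simp⟩
  have h3 := congrArg (fun f : C(ℝ, ℂ) => f 1) (h1.trans h2.symm)
  simp only [ContinuousMap.add_apply, ContinuousMap.const_apply] at h3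
  rw [h3]
  ring

lemma exists_int_log_increment {a b z : ℂ} (γ : Path a b) (hz : ∀ t, γ t ≠ z) {la lb : ℂ}
    (ha : Complex.exp la = a - z) (hb : Complex.exp lb = b - z) :
    ∃ n : ℤ, ∀ L : C(ℝ, ℂ), (∀ s, Complex.exp (L s) = γ.extend s - z) →
      L 1 - L 0 = lb - la + 2 * Real.pi * Complex.I * n := by
  have hz' : ∀ s, γ.extend s - z ≠ 0 := by
    intro s h
    obtain ⟨t, ht⟩ : γ.extend s ∈ Set.range γ := by
      rw [← Path.extend_range]
      exact ⟨s, rfl⟩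
    exact hz t (ht.trans (sub_eq_zero.1 h))
  obtain ⟨L₀, hL₀⟩ := exists_continuous_log
    (⟨fun s => γ.extend s - z, by fun_prop⟩ : C(ℝ, ℂ)) hz'
  simp only [ContinuousMap.coe_mk] at hL₀
  obtain ⟨m, hm⟩ := Complex.exp_eq_exp_iff_exists_int.1
    (show Complex.exp (L₀ 0) = Complex.exp la by rw [hL₀, ha]; simp)
  obtain ⟨m', hm'⟩ := Complex.exp_eq_exp_iff_exists_int.1
    (show Complex.exp (L₀ 1) = Complex.exp lb by rw [hL₀, hb]; simp)
  refine ⟨m' - m, fun L hL => ?_⟩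
  rw [log_increment_unique (L := L) (L' := L₀) fun s => by rw [hL, hL₀], hm, hm']
  push_cast
  ring

/-- There is no map of the complete graph on five vertices to the plane for which disjoint
edges have disjoint images. -/
theorem not_exists_disjoint_paths (p : Fin 5 → ℂ) (γ : ∀ i j, Path (p i) (p j))
    (hp : Function.Injective p)
    (hv : ∀ i j k, i ≠ j → k ≠ i → k ≠ j → ∀ t, γ i j t ≠ p k)
    (hd : ∀ i j k l, i ≠ j → k ≠ l → i ≠ k → i ≠ l → j ≠ k → j ≠ l → ∀ s t, γ i j s ≠ γ k l t) :
    False := by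
  -- Logarithms of `p y - p x` chosen so that reversing the pair changes them by exactly `πi` up to
  -- the sign `σ`.
  set Λ : Fin 5 → Fin 5 → ℂ := fun x y => if x < y then Complex.log (p y - p x) else
    Complex.log (p x - p y) + Real.pi * Complex.I
  have hΛ : ∀ x y, x ≠ y → Complex.exp (Λ x y) = p y - p x := by
    intro x y hxy
    simp only [Λ]
    split_ifs
    · exact Complex.exp_log (sub_ne_zero.2 (hp.ne hxy.symm))
    · rw [Complex.exp_add, Complex.exp_log (sub_ne_zero.2 (hp.ne hxy)), Complex.exp_pi_mul_I]
      ring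
  set σ : Fin 5 → Fin 5 → ℤ := fun x y => if x < y then -1 else 1
  have hσ : ∀ x y, x ≠ y → Λ x y - Λ y x = Real.pi * Complex.I * σ x y := by
    intro x y hxy
    rcases lt_or_gt_of_ne hxy with h | h
    · simp [Λ, σ, h, h.not_gt]
    · simp [Λ, σ, h, h.not_gt]
  have hn : ∀ k i j, ∃ n : ℤ, i ≠ j → k ≠ i → k ≠ j →
      ∀ L : C(ℝ, ℂ), (∀ s, Complex.exp (L s) = (γ i j).extend s - p k) →
        L 1 - L 0 = Λ k j - Λ k i + 2 * Real.pi * Complex.I * n := by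
    intro k i j
    by_cases h : i ≠ j ∧ k ≠ i ∧ k ≠ j
    · obtain ⟨n, hn⟩ := exists_int_log_increment (γ i j) (hv i j k h.1 h.2.1 h.2.2)
        (hΛ k i h.2.1) (hΛ k j h.2.2)
      exact ⟨n, fun _ _ _ => hn⟩
    · exact ⟨0, fun h1 h2 h3 => absurd ⟨h1, h2, h3⟩ h⟩
  choose n hn using hn
  -- For disjoint edges the difference of the two paths never vanishes on the parameter plane, so it
  -- has a continuous logarithm there. Its increments around the unit square cancel, and dividing by
  -- `πi` leaves an equation in integers.
  have key : ∀ i j k l, i ≠ j → k ≠ l → i ≠ k → i ≠ l → j ≠ k → j ≠ l →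
      σ k j + σ j l + σ l i + σ i k + 2 * (n k i j + n j k l - n l i j - n i k l) = 0 := by
    intro i j k l hij hkl hik hil hjk hjl
    obtain ⟨L, hL⟩ := exists_continuous_log
      (⟨fun x => (γ i j).extend x.1 - (γ k l).extend x.2, by fun_prop⟩ : C(ℝ × ℝ, ℂ)) (by
        rintro ⟨s, t⟩ h
        obtain ⟨s', hs'⟩ : (γ i j).extend s ∈ Set.range (γ i j) := by
          rw [← Path.extend_range]
          exact ⟨s, rfl⟩
        obtain ⟨t', ht'⟩ : (γ k l).extend t ∈ Set.range (γ k l) := by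
          rw [← Path.extend_range]
          exact ⟨t, rfl⟩
        exact hd i j k l hij hkl hik hil hjk hjl s' t'
          (hs'.trans ((sub_eq_zero.1 h).trans ht'.symm)))
    simp only [ContinuousMap.coe_mk, Prod.forall] at hL
    have e1 := hn k i j hij hik.symm hjk.symm ⟨fun s => L (s, 0), by fun_prop⟩
      fun s => by simp [hL]
    have e2 := hn l i j hij hil.symm hjl.symm ⟨fun s => L (s, 1), by fun_prop⟩
      fun s => by simp [hL]
    -- The shift by `πi` turns the logarithm of `p j - γ k l` into one of `γ k l - p j`.
    have e3 := hn j k l hkl hjk hjl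
      ⟨fun t => L (1, t) + Real.pi * Complex.I, by fun_prop⟩
      fun t => by simp [hL, Complex.exp_add]
    have e4 := hn i k l hkl hik hil ⟨fun t => L (0, t) + Real.pi * Complex.I, by fun_prop⟩
      fun t => by simp [hL, Complex.exp_add]
    simp only [ContinuousMap.coe_mk] at e1 e2 e3 e4
    have s1 := hσ k j hjk.symm
    have s2 := hσ j l hjl
    have s3 := hσ l i hil.symm
    have s4 := hσ i k hik
    have hπ : (Real.pi : ℂ) * Complex.I ≠ 0 :=
      mul_ne_zero (by exact_mod_cast Real.pi_ne_zero) Complex.I_ne_zero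
    have : (Real.pi : ℂ) * Complex.I *
        ((σ k j + σ j l + σ l i + σ i k + 2 * (n k i j + n j k l - n l i j - n i k l) : ℤ) : ℂ)
        = 0 := by
      push_cast
      linear_combination -s1 - s2 - s3 - s4 - e1 + e2 - e3 + e4
    exact_mod_cast (mul_eq_zero.1 this).resolve_left hπ
  -- The fifteen pairs of disjoint edges. Each integer `n` occurs in exactly two of the equations
  -- with coefficient `±2`, so in the sum they contribute a multiple of 4. For each of the five
  -- quadruples, just one of its three pairings has a nonzero sum of signs, namely `-2`. The total
  -- `-10` is not divisible by 4.
  have h1 := key 0 1 2 3 (by decide) (by decide) (by decide) (by decide) (by decide) (by decide)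
  have h2 := key 0 1 2 4 (by decide) (by decide) (by decide) (by decide) (by decide) (by decide)
  have h3 := key 0 1 3 4 (by decide) (by decide) (by decide) (by decide) (by decide) (by decide)
  have h4 := key 0 2 1 3 (by decide) (by decide) (by decide) (by decide) (by decide) (by decide)
  have h5 := key 0 2 1 4 (by decide) (by decide) (by decide) (by decide) (by decide) (by decide)
  have h6 := key 0 2 3 4 (by decide) (by decide) (by decide) (by decide) (by decide) (by decide)
  have h7 := key 0 3 1 2 (by decide) (by decide) (by decide) (by decide) (by decide) (by decide)
  have h8 := key 0 3 1 4 (by decide) (by decide) (by decide) (by decide) (by decide) (by decide)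
  have h9 := key 0 3 2 4 (by decide) (by decide) (by decide) (by decide) (by decide) (by decide)
  have h10 := key 0 4 1 2 (by decide) (by decide) (by decide) (by decide) (by decide) (by decide)
  have h11 := key 0 4 1 3 (by decide) (by decide) (by decide) (by decide) (by decide) (by decide)
  have h12 := key 0 4 2 3 (by decide) (by decide) (by decide) (by decide) (by decide) (by decide)
  have h13 := key 1 2 3 4 (by decide) (by decide) (by decide) (by decide) (by decide) (by decide)
  have h14 := key 1 3 2 4 (by decide) (by decide) (by decide) (by decide) (by decide) (by decide)
  have h15 := key 1 4 2 3 (by decide) (by decide) (by decide) (by decide) (by decide) (by decide)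
  have hlt : ∀ x y : Fin 5, x < y → σ x y = -1 ∧ σ y x = 1 := fun x y h => by
    simp [σ, h, h.not_gt]
  simp only [hlt 0 1 (by decide), hlt 0 2 (by decide), hlt 0 3 (by decide), hlt 0 4 (by decide),
    hlt 1 2 (by decide), hlt 1 3 (by decide), hlt 1 4 (by decide), hlt 2 3 (by decide),
    hlt 2 4 (by decide), hlt 3 4 (by decide)] at h1 h2 h3 h4 h5 h6 h7 h8 h9 h10 h11 h12 h13 h14 h15
  clear hlt key hn hσ hΛ
  omega

end Winding

/-! ### Planar graphs have no complete minor on five vertices -/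

section Planar

variable {V : Type*} {G : SimpleGraph V} {p : V → EuclideanSpace ℝ (Fin 2)}
  {γ : G.edgeSet → C(unitInterval, EuclideanSpace ℝ (Fin 2))}

/-- The drawing of the subgraph induced on `U`. -/
def drawn (p : V → EuclideanSpace ℝ (Fin 2))
    (γ : G.edgeSet → C(unitInterval, EuclideanSpace ℝ (Fin 2))) (U : Set V) :
    Set (EuclideanSpace ℝ (Fin 2)) :=
  {z | (∃ u ∈ U, p u = z) ∨ ∃ e : G.edgeSet, (∀ u ∈ (e : Sym2 V), u ∈ U) ∧ ∃ t, γ e t = z}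

lemma mem_drawn (hends : ∀ e, s(γ e 0, γ e 1) = Sym2.map p (e : Sym2 V)) {U : Set V}
    {z : EuclideanSpace ℝ (Fin 2)} (hz : z ∈ drawn p γ U) :
    (∃ u ∈ U, p u = z) ∨ ∃ e : G.edgeSet, (∀ u ∈ (e : Sym2 V), u ∈ U) ∧
      ∃ t ∈ Set.Ioo (0 : unitInterval) 1, γ e t = z := by
  rcases hz with h | ⟨e, he, t, rfl⟩
  · exact Or.inl h
  · have hend : ∀ x ∈ s(γ e 0, γ e 1), ∃ u ∈ U, p u = x := by
      intro x hx
      rw [hends, Sym2.mem_map] at hx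
      obtain ⟨u, hu, h⟩ := hx
      exact ⟨u, he u hu, h⟩
    by_cases h0 : t = 0
    · exact Or.inl (h0 ▸ hend _ (by simp))
    · by_cases h1 : t = 1
      · exact Or.inl (h1 ▸ hend _ (by simp))
      · exact Or.inr ⟨e, he, t,
          ⟨unitInterval.pos_iff_ne_zero.2 h0, unitInterval.lt_one_iff_ne_one.2 h1⟩, rfl⟩

lemma disjoint_drawn (hp : Function.Injective p)
    (hends : ∀ e, s(γ e 0, γ e 1) = Sym2.map p (e : Sym2 V))
    (hv : ∀ e, ∀ t ∈ Set.Ioo (0 : unitInterval) 1, ∀ v, γ e t ≠ p v)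
    (he : ∀ e f, e ≠ f → ∀ s ∈ Set.Ioo (0 : unitInterval) 1, ∀ t ∈ Set.Ioo (0 : unitInterval) 1,
      γ e s ≠ γ f t) {U U' : Set V} (hU : Disjoint U U') :
    Disjoint (drawn p γ U) (drawn p γ U') := by
  rw [Set.disjoint_left] at hU ⊢
  intro z hz hz'
  rcases mem_drawn hends hz with ⟨u, hu, rfl⟩ | ⟨e, heU, s, hs, rfl⟩ <;>
    rcases mem_drawn hends hz' with ⟨u', hu', h⟩ | ⟨f, hfU, t, ht, h⟩
  · exact hU hu (hp h ▸ hu')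
  · exact hv f t ht u h
  · exact hv e s hs u' h.symm
  · refine he e f ?_ s hs t ht h.symm
    rintro rfl
    obtain ⟨e, hemem⟩ := e
    induction e with
    | h x y => exact hU (heU x (by simp)) (hfU x (by simp))

lemma joinedIn_drawn (hends : ∀ e, s(γ e 0, γ e 1) = Sym2.map p (e : Sym2 V)) {U : Set V}
    {x y : U} (h : (G.induce U).Reachable x y) : JoinedIn (drawn p γ U) (p x) (p y) := by
  obtain ⟨q⟩ := h
  induction q with
  | nil => exact JoinedIn.refl (Or.inl ⟨_, Subtype.coe_prop _, rfl⟩)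
  | @cons a b c hab q ih =>
    refine JoinedIn.trans ?_ ih
    set e : G.edgeSet := ⟨s(a.1, b.1), hab⟩
    have hmem : ∀ t, γ e t ∈ drawn p γ U := by
      refine fun t => Or.inr ⟨e, fun u hu => ?_, t, rfl⟩
      rcases Sym2.mem_iff.1 hu with rfl | rfl
      exacts [a.2, b.2]
    have hj : JoinedIn (drawn p γ U) (γ e 0) (γ e 1) := ⟨⟨γ e, rfl, rfl⟩, hmem⟩
    have hab' := hends e
    simp only [e, Sym2.map_mk, Sym2.eq_iff] at hab'
    rcases hab' with ⟨h0, h1⟩ | ⟨h0, h1⟩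
    · rw [← h0, ← h1]
      exact hj
    · rw [← h0, ← h1]
      exact hj.symm

/-- Pick a centre in each branch set and join two centres inside the drawing of the union of their
branch sets. These paths may meet when they share an end, but disjoint pairs use disjoint vertex
sets and so have disjoint drawings, which is all that the obstruction needs. -/
theorem IsPlanar.not_isMinor (hG : IsPlanar G) : ¬ IsMinor (⊤ : SimpleGraph (Fin 5)) G := by
  rintro ⟨B, hB, hBd, hBa⟩
  obtain ⟨p, γ, hp, -, hends, hv, he⟩ := hG
  have hc : ∀ i, ∃ v, v ∈ B i := fun i => Set.nonempty_coe_sort.1 (hB i).nonempty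
  choose c hc using hc
  have hdis : ∀ {U U' : Set V}, Disjoint U U' → Disjoint (drawn p γ U) (drawn p γ U') :=
    disjoint_drawn hp hends hv he
  have hin : ∀ {U : Set V} i (hU : B i ⊆ U) u v (hu : u ∈ B i) (hv : v ∈ B i),
      (G.induce U).Reachable ⟨u, hU hu⟩ ⟨v, hU hv⟩ := fun i hU u v hu hv =>
    ((hB i).preconnected ⟨u, hu⟩ ⟨v, hv⟩).map (induceHomOfLE G hU).toHom
  have hjoin : ∀ i j, JoinedIn (drawn p γ (B i ∪ B j)) (p (c i)) (p (c j)) := by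
    intro i j
    by_cases hij : i = j
    · subst hij
      exact JoinedIn.refl (Or.inl ⟨c i, Or.inl (hc i), rfl⟩)
    · obtain ⟨a, ha, b, hb, hab⟩ := hBa i j hij
      have h1 := hin i Set.subset_union_left (c i) a (hc i) ha (U := B i ∪ B j)
      have h2 := hin j Set.subset_union_right b (c j) hb (hc j) (U := B i ∪ B j)
      have h3 : (G.induce (B i ∪ B j)).Adj ⟨a, Or.inl ha⟩ ⟨b, Or.inr hb⟩ := hab
      exact joinedIn_drawn hends ((h1.trans h3.reachable).trans h2)
  have hmem : ∀ i, p (c i) ∈ drawn p γ (B i) := fun i => Or.inl ⟨c i, hc i, rfl⟩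
  set φ := Complex.orthonormalBasisOneI.repr.symm
  refine not_exists_disjoint_paths (fun i => φ (p (c i)))
    (fun i j => (hjoin i j).somePath.map φ.continuous) ?_ ?_ ?_
  · intro i j hij
    by_contra hne
    have := hp (φ.injective hij)
    exact Set.disjoint_left.1 (hBd i j hne) (hc i) (this ▸ hc j)
  · intro i j k _ hki hkj t h
    have h := φ.injective h
    exact Set.disjoint_left.1 (hdis (Set.disjoint_union_left.2 ⟨hBd i k hki.symm,
      hBd j k hkj.symm⟩)) ((hjoin i j).somePath_mem t) (h ▸ hmem k)
  · intro i j k l _ _ hik hil hjk hjl s t h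
    have h := φ.injective h
    exact Set.disjoint_left.1 (hdis (Set.disjoint_union_left.2
      ⟨Set.disjoint_union_right.2 ⟨hBd i k hik, hBd i l hil⟩,
        Set.disjoint_union_right.2 ⟨hBd j k hjk, hBd j l hjl⟩⟩))
      ((hjoin i j).somePath_mem s) (h ▸ (hjoin k l).somePath_mem t)

end Planar

/-! ### The ratio for graphs without a large complete minor -/

section Ratio

variable {V : Type*} [Fintype V] [DecidableEq V] {G : SimpleGraph V} {w : Sym2 V → ℝ} {k : ℕ}

/-- The greedy algorithm beats the ratio two on graphs without a large complete minor. -/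
theorem greedyApproximates_of_not_isMinor (hG : G.Connected) (hw : ∀ e ∈ G.edgeSet, 0 ≤ w e)
    (hk : 1 ≤ k) (hkV : k ≤ Fintype.card V) {t c : ℕ} (hc : 1 ≤ c) (htc : 2 ^ t ≤ 2 * c)
    (hminor : ¬ IsMinor (⊤ : SimpleGraph (Fin (t + 2))) G) :
    GreedyApproximates (2 - 1 / (70 * c)) G w k := by
  classical
  refine greedyApproximates_of_pricing hG hw hk hkV ?_
  rintro S ⟨hSG, -, hS⟩
  have hcard : Nat.card (remove G S).ConnectedComponent = k := by
    have := numComp_eq_one hG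
    rw [numComp] at hS
    omega
  set e := Finite.equivFinOfCardEq hcard
  set f : V → Fin k := fun v => e ((remove G S).connectedComponentMk v)
  have hf : Function.Surjective f := e.surjective.comp fun K => K.exists_rep
  have hconn : ∀ i, (G.induce (f ⁻¹' {i})).Connected := by
    intro i
    have : f ⁻¹' {i} = (e.symm i).supp := by
      ext v
      simp [f, ← e.symm_apply_eq, eq_comm]
    rw [this]
    exact ((e.symm i).connected_toSimpleGraph).mono (comap_monotone _ remove_le)
  refine exists_pricing hf hSG (fun x y hxy hne => ?_) hw hc fun s => ?_
  · by_contra hxS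
    exact hne (congrArg e (ConnectedComponent.sound
      (Adj.reachable (remove_adj.2 ⟨hxy, hxS⟩))))
  · intro _
    -- A dense set of cells would yield a complete minor of the quotient. The cells are connected,
    -- so the quotient is a minor of `G`.
    by_contra hlt
    push Not at hlt
    have hs : s.Nonempty := by
      rw [Finset.nonempty_iff_ne_empty]
      rintro rfl
      simp at hlt
    have : Nonempty (s : Set (Fin k)) := hs.coe_sort
    refine hminor ((isMinor_top_of_le_degSum t ((quot G f).induce (s : Set (Fin k))) ?_).trans
      ((isMinor_induce _ _).trans (isMinor_quot hconn)))
    have hcs : Fintype.card (s : Set (Fin k)) = s.card := by simp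
    have hds : degSum ((quot G f).induce (s : Set (Fin k))) =
        ∑ i ∈ s, (s.filter ((quot G f).Adj i)).card := by
      convert degSum_induce (quot G f) s
    rw [hcs, hds]
    exact (Nat.mul_le_mul_right _ htc).trans hlt.le

end Ratio

end KCut

theorem theorem1 :
    (∃ ε : ℕ → ℝ, (∀ h, 0 < ε h) ∧
      ∀ (W : Type*) [Fintype W] (H : SimpleGraph W)
        (V : Type*) [Fintype V] [DecidableEq V] (G : SimpleGraph V) (w : Sym2 V → ℝ) (k : ℕ),
        G.Connected → ¬ KCut.IsMinor H G → (∀ e ∈ G.edgeSet, 0 ≤ w e) →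
        1 ≤ k → k ≤ Fintype.card V →
        KCut.GreedyApproximates (2 - ε (Fintype.card W) / 3) G w k) ∧
    (∀ (V : Type*) [Fintype V] [DecidableEq V] (G : SimpleGraph V) (w : Sym2 V → ℝ) (k : ℕ),
        G.Connected → KCut.IsPlanar G → (∀ e ∈ G.edgeSet, 0 ≤ w e) →
        1 ≤ k → k ≤ Fintype.card V →
        KCut.GreedyApproximates (2 - 1 / 315) G w k) := by
  -- This is `3 / (70c)` with `c = 2 ^ h`; a complete minor on `h + 2` vertices contains every graph
  -- on `h` vertices.
  refine ⟨⟨fun h => 3 / (70 * 2 ^ h), fun h => by positivity, ?_⟩, ?_⟩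
  · intro W _ H V _ _ G w k hG hH hw hk hkV
    have := KCut.greedyApproximates_of_not_isMinor hG hw hk hkV (t := Fintype.card W)
      (c := 2 ^ Fintype.card W) Nat.one_le_two_pow (by omega)
      fun h => hH (h.of_top H (by omega))
    convert this using 1
    push_cast
    field_simp
  · intro V _ _ G w k hG hpl hw hk hkV
    -- Five branch sets correspond to `t = 3`, so `c = 4` is enough and gives `2 - 1/280`, slightly
    -- below the required `2 - 1/315`.
    obtain ⟨h1, h2, h3⟩ := KCut.greedyApproximates_of_not_isMinor hG hw hk hkV (t := 3) (c := 4)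
      (by norm_num) (by norm_num) hpl.not_isMinor
    refine ⟨h1, h2, fun D hD => ⟨(h3 D hD).1, fun S hS => ((h3 D hD).2 S hS).trans ?_⟩⟩
    exact mul_le_mul_of_nonneg_right (by norm_num)
      (Finset.sum_nonneg fun e he => hw e (hS.1 he))
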